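/- Let $X,Y,Z$ be the Pauli matrices, and write two-qubit operators as $4\times4$ matrices in the basis $|00\rangle,|01\rangle,|10\rangle,|11\rangle$. A unitary two-qubit operator $U$ is a *Clifford gate* if conjugation by $U$ maps the Pauli group $\{i^k\sigma_a\otimes\sigma_b\}$ into itself; a *matchgate* if its only nonzero entries lie on the diagonal and the antidiagonal (X-type) and $\det A=\det C$, where $A$ is its block on $\mathrm{span}(|00\rangle,|11\rangle)$ and $C$ its block on $\mathrm{span}(|01\rangle,|10\rangle)$ (a *nontrivial* matchgate if moreover it is not a multiple of the identity); *dual-unitary* if $\tilde U$ is also unitary, where $\langle mn|\tilde U|ij\rangle=\langle jn|U|im\rangle$. A nonzero matrix represents the gate obtained by multiplying it by a nonzero scalar (normalization and global phase); "is a gate" means that such a multiple is unitary. For real $\varphi_j$ let $$B_I=\begin{pmatrix}e^{i\varphi_1}&0&0&0\\0&0&e^{i\varphi_2}&0\\0&e^{i\varphi_3}&0&0\\0&0&0&e^{i\varphi_1}\end{pmatrix},\quad B_{II}=\begin{pmatrix}0&0&0&e^{i\varphi_2}\\0&e^{i\varphi_1}&0&0\\0&0&e^{i\varphi_1}&0\\e^{i\varphi_3}&0&0&0\end{pmatrix},$$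 $$B_{III}=\begin{pmatrix}\cos\varphi_1&0&0&e^{i\varphi_2}\sin\varphi_1\\0&-i\sin\varphi_1&-\cos\varphi_1&0\\0&-\cos\varphi_1&-i\sin\varphi_1&0\\-e^{-i\varphi_2}\sin\varphi_1&0&0&\cos\varphi_1\end{pmatrix},\quad R_{IV}(\chi)=\begin{pmatrix}\cos\chi&0&0&e^{i\varphi_1}\sin\chi\\0&\cos\chi&\sin\chi&0\\0&-\sin\chi&\cos\chi&0\\-e^{-i\varphi_1}\sin\chi&0&0&\cos\chi\end{pmatrix}.$$ Put $(\lambda_1,\lambda_2,\lambda_3)=(-e^{i(\varphi_2+\varphi_3)/2},e^{i\varphi_1},e^{i(\varphi_2+\varphi_3)/2})$ for $l\in\{I,II\}$ and $(-e^{i\varphi_1},e^{-i\varphi_1},e^{i\varphi_1})$ for $l=III$ (the eigenvalues of $B_l$), $x=e^{\mu}$ with $\mu\in\mathbb R$, and $$R_{l,1}=-\tfrac{x-1}{\lambda_3}B_l+\Bigl(1+\tfrac{\lambda_1}{\lambda_2}+\tfrac{\lambda_1}{\lambda_3}+\tfrac{\lambda_2}{\lambda_3}\Bigr)x\,\mathbb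 1+\lambda_1x(x-1)B_l^\dagger,$$ $$R_{l,2}=-\tfrac1{\lambda_3}B_l+\lambda_2xB_l^\dagger,\qquad R_{l,3}=-\tfrac1{\lambda_2}B_l+\lambda_1xB_l^\dagger,$$ where in $R_{l,2},R_{l,3}$ the common scalar factor $x-1$ of the Yang–Baxterization has been removed. Let $\varphi=\frac12(\varphi_2+\varphi_3)-\varphi_1$ and $\omega=\frac12(\varphi_2-\varphi_3)$. Consider the equations $$(E_2)\ \tanh\tfrac\mu2=\pm\tan\tfrac\varphi2\ \ (\cos\tfrac\varphi2\ne0),\qquad (E_3)\ \tanh\tfrac\mu2=\pm\cot\tfrac\varphi2\ \ (\sin\tfrac\varphi2\neq0).$$ Each statement about $R_{l,k}$ at a finite $\mu$ is for parameters at which the matrix $R_{l,k}$ is nonzero. Then the following hold. 1. $R_{l,1}$, $l\in\{I,II\}$, is a gate. It is Clifford if $\omega\in\pi\mathbb Z$ and ($\mu=0$ or $\varphi\in\pi\mathbb Z$); precisely, it is Clifford iff $\mu=0$, or $\varphi\in\pi\mathbb Z$ and $\omega\in\frac\pi2\mathbb Z$. It is a matchgate iff $\mu=0$ or $\varphi\in\frac\pi2+\pi\mathbb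 Z$, and a nontrivial matchgate iff $\mu\ne0$ and $\varphi\in\frac\pi2+\pi\mathbb Z$. At finite $\mu$ it is dual-unitary iff $\varphi\in\pi\mathbb Z$; for all parameters, as $\mu\to-\infty$, $R_{l,1}$ converges to $\lambda_3^{-1}B_l$, which is dual-unitary. 2. $R_{l,2}$, $l\in\{I,II\}$, is Clifford if $\omega\in\pi\mathbb Z$ and ($\mu=0$ or $\varphi\in\pi\mathbb Z$ or $(E_2)$); precisely, iff $\omega\in\frac\pi2\mathbb Z$ and ($\mu=0$ or $\varphi\in\pi\mathbb Z$ or $(E_2)$). It is a matchgate iff $(E_2)$, and it is always dual-unitary. 3. The same holds for $R_{l,3}$, $l\in\{I,II\}$, with $(E_3)$ in place of $(E_2)$. 4. $R_{III,1}$ is a gate. It is Clifford if $\varphi_2\in\frac\pi2+\pi\mathbb Z$ and ($\mu=0$ or $\varphi_1\in\frac\pi2\mathbb Z$); precisely, iff $\mu=0$, or $\varphi_1\in\pi\mathbb Z$, or $\varphi_1\in\frac\pi2+\pi\mathbb Z$ and $\varphi_2\in\frac\pi2\mathbb Z$. It is a matchgate only for $\mu=0$ (where it is one), and it is never a nontrivial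 matchgate. At finite $\mu$ it is dual-unitary iff $\varphi_1\in\frac\pi2\mathbb Z$; for all parameters, as $\mu\to-\infty$, $R_{III,1}$ converges to $\lambda_3^{-1}B_{III}$, which is dual-unitary. 5. $R_{III,2}$ is Clifford if $\varphi_2\in\frac\pi2+\pi\mathbb Z$ and ($\mu=0$ or $\varphi_1\in\frac\pi2+\pi\mathbb Z$ or $\varphi_1\in\pi\mathbb Z$); precisely, iff $\varphi_1\in\pi\mathbb Z$, or ($\mu=0$ or $\varphi_1\in\frac\pi2+\pi\mathbb Z$) and $\varphi_2\in\frac\pi2\mathbb Z$, or $\cos\varphi_1\neq0$, $\tanh\frac\mu2=\pm\tan\varphi_1$ and $\varphi_2\in\frac\pi2+\pi\mathbb Z$. It is never a matchgate and always dual-unitary. 6. $R_{III,3}$ is Clifford if $\varphi_2\in\frac\pi2+\pi\mathbb Z$ and ($\mu=0$ or $\varphi_1\in\frac\pi2+\pi\mathbb Z$ or $\varphi_1\in\pi\mathbb Z$); precisely, iff $\mu=0$, or $\varphi_1\in\pi\mathbb Z$, or $\varphi_1\in\frac\pi2+\pi\mathbb Z$ and $\varphi_2\in\frac\pi2\mathbb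 Z$, or $\sin\varphi_1\ne0$, $\tanh\frac\mu2=\pm\cot\varphi_1$ and $\varphi_2\in\frac\pi2+\pi\mathbb Z$. It is never a matchgate and always dual-unitary. 7. For all $\varphi_1,\chi\in\mathbb R$, $R_{IV}(\chi)$ is Clifford if $\varphi_1\in\pi\mathbb Z$ and $\chi\in\frac\pi4\mathbb Z$; precisely, iff $\chi\in\pi\mathbb Z$, or $\chi\in\frac\pi2+\pi\mathbb Z$ and $\varphi_1\in\frac\pi2\mathbb Z$, or $\chi\in\frac\pi4+\frac\pi2\mathbb Z$ and $\varphi_1\in\pi\mathbb Z$. It is always a matchgate and never dual-unitary. -/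

import Mathlib

open Real Filter Topology
open scoped Matrix Kronecker

noncomputable section

/-- Operators on two qubits; the index `(a, b)` stands for the computational basis vector
`|a⟩ ⊗ |b⟩`. -/
abbrev TwoQubit : Type := Matrix (Fin 2 × Fin 2) (Fin 2 × Fin 2) ℂ

/-- The two-qubit operator whose matrix in the ordered basis `|00⟩, |01⟩, |10⟩, |11⟩` is `M`. -/
def ofBasis (M : Matrix (Fin 4) (Fin 4) ℂ) : TwoQubit :=
  fun p q => M (finProdFinEquiv p) (finProdFinEquiv q)

/-- The phase `e^{iθ}`. -/
def phase (θ : ℝ) : ℂ := Complex.exp (Complex.I * θ)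

/-! ### Clifford gates, matchgates, dual-unitary gates -/

/-- The identity and the three Pauli matrices. -/
def pauli : Fin 4 → Matrix (Fin 2) (Fin 2) ℂ :=
  ![1, !![0, 1; 1, 0], !![0, -Complex.I; Complex.I, 0], !![1, 0; 0, -1]]

/-- The two-qubit Pauli group `{i^k σ_a ⊗ σ_b}`. -/
def pauliGroup : Set TwoQubit :=
  {P | ∃ (k : Fin 4) (a b : Fin 4), P = Complex.I ^ (k : ℕ) • (pauli a ⊗ₖ pauli b)}

/-- A Clifford gate is a unitary that preserves the Pauli group under conjugation. -/
def IsClifford (U : TwoQubit) : Prop :=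
  U ∈ Matrix.unitaryGroup (Fin 2 × Fin 2) ℂ ∧ ∀ P ∈ pauliGroup, U * P * Uᴴ ∈ pauliGroup

/-- A matchgate: a unitary of X-type, with block `A` on the span of `|00⟩, |11⟩` and block `C` on
the span of `|01⟩, |10⟩`, such that `det A = det C`. -/
def IsMatchgate (U : TwoQubit) : Prop :=
  U ∈ Matrix.unitaryGroup (Fin 2 × Fin 2) ℂ ∧
    ∃ A C : Matrix (Fin 2) (Fin 2) ℂ, A.det = C.det ∧
      U = ofBasis !![A 0 0, 0, 0, A 0 1;
                     0, C 0 0, C 0 1, 0;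
                     0, C 1 0, C 1 1, 0;
                     A 1 0, 0, 0, A 1 1]

/-- A matchgate that is not proportional to the identity. -/
def IsNontrivialMatchgate (U : TwoQubit) : Prop :=
  IsMatchgate U ∧ ¬ ∃ c : ℂ, U = c • (1 : TwoQubit)

/-- The reshuffled operator: `⟨m n| Ũ |i j⟩ = ⟨j n| U |i m⟩`. -/
def dualOp (U : TwoQubit) : TwoQubit :=
  fun p q => U (q.2, p.2) (q.1, p.1)

/-- A dual-unitary gate: both `U` and the reshuffled `Ũ` are unitary. -/
def IsDualUnitary (U : TwoQubit) : Prop :=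
  U ∈ Matrix.unitaryGroup (Fin 2 × Fin 2) ℂ ∧
    dualOp U ∈ Matrix.unitaryGroup (Fin 2 × Fin 2) ℂ

/-- The gate represented by the matrix `M`, which is given only up to a nonzero scalar
(normalization and global phase), has the property `P`. -/
def UpToScalar (P : TwoQubit → Prop) (M : TwoQubit) : Prop :=
  ∃ c : ℂ, c ≠ 0 ∧ P (c • M)

/-! ### Yang-Baxterization -/

/-- The coefficients `α(x, λ₃)`, `β(x, λ₁, λ₂, λ₃)`, `γ(x, λ₁)` of the Yang-Baxterization of a braid
gate with three eigenvalues. -/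
def ybAlpha (x l₃ : ℂ) : ℂ := -(1 / l₃) * (x - 1)

def ybBeta (x l₁ l₂ l₃ : ℂ) : ℂ := (1 + l₁ / l₂ + l₁ / l₃ + l₂ / l₃) * x

def ybGamma (x l₁ : ℂ) : ℂ := l₁ * x * (x - 1)

/-- `R(x) = α(x, λ₃) B + β(x, λ₁, λ₂, λ₃) 1 + γ(x, λ₁) B†`. -/
def ybThree (B : TwoQubit) (l₁ l₂ l₃ x : ℂ) : TwoQubit :=
  ybAlpha x l₃ • B + ybBeta x l₁ l₂ l₃ • (1 : TwoQubit) + ybGamma x l₁ • Bᴴ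

/-- `α(x, l) B + γ(x, l') B†` with its common scalar factor `x - 1` removed (see `ybTwo_spec`),
so that the gate is also defined at `x = 1`. -/
def ybTwo (B : TwoQubit) (l l' x : ℂ) : TwoQubit :=
  (-(1 / l)) • B + (l' * x) • Bᴴ

theorem ybTwo_spec (B : TwoQubit) (l l' x : ℂ) :
    (x - 1) • ybTwo B l l' x = ybAlpha x l • B + ybGamma x l' • Bᴴ := by
  simp only [ybTwo, ybAlpha, ybGamma, smul_add, smul_smul]
  congr 2 <;> ring

/-! ### The braid gates -/

def braidI (φ₁ φ₂ φ₃ φ₄ : ℝ) : TwoQubit :=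
  ofBasis !![phase φ₁, 0, 0, 0;
             0, 0, phase φ₂, 0;
             0, phase φ₃, 0, 0;
             0, 0, 0, phase φ₄]

def braidII (φ₁ φ₂ φ₃ : ℝ) : TwoQubit :=
  ofBasis !![0, 0, 0, phase φ₂;
             0, phase φ₁, 0, 0;
             0, 0, phase φ₁, 0;
             phase φ₃, 0, 0, 0]

def braidIII (φ₁ φ₂ : ℝ) : TwoQubit :=
  ofBasis !![(cos φ₁ : ℂ), 0, 0, sin φ₁ * phase φ₂;
             0, -Complex.I * sin φ₁, -(cos φ₁ : ℂ), 0;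
             0, -(cos φ₁ : ℂ), -Complex.I * sin φ₁, 0;
             -(sin φ₁ : ℂ) * phase (-φ₂), 0, 0, (cos φ₁ : ℂ)]

def braidIV (φ₁ : ℝ) : TwoQubit :=
  (1 / (√2 : ℂ)) • ofBasis !![1, 0, 0, phase φ₁;
                             0, 1, 1, 0;
                             0, -1, 1, 0;
                             -phase (-φ₁), 0, 0, 1]

/-! ### The Yang-Baxter gates, in the additive spectral parameter `μ = ln x`, `x > 0` -/

/-- The labels `I` and `II`. -/
inductive BraidLabel
  | I
  | II

/-- `B_I` (restricted to `φ₄ = φ₁`) and `B_II`; both have the eigenvalues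
`λ₁ = -e^{i(φ₂+φ₃)/2}`, `λ₂ = e^{iφ₁}`, `λ₃ = e^{i(φ₂+φ₃)/2}`. -/
def braidGate : BraidLabel → ℝ → ℝ → ℝ → TwoQubit
  | .I, φ₁, φ₂, φ₃ => braidI φ₁ φ₂ φ₃ φ₁
  | .II, φ₁, φ₂, φ₃ => braidII φ₁ φ₂ φ₃

/-- `R_{l,1}` for `l = I, II`. -/
def gate1 (l : BraidLabel) (φ₁ φ₂ φ₃ μ : ℝ) : TwoQubit :=
  ybThree (braidGate l φ₁ φ₂ φ₃)
    (-phase ((φ₂ + φ₃) / 2)) (phase φ₁) (phase ((φ₂ + φ₃) / 2)) (exp μ : ℝ)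

/-- `R_{l,2} = α(x, λ₃) B + γ(x, λ₂) B†` for `l = I, II`, up to the factor `x - 1`. -/
def gate2 (l : BraidLabel) (φ₁ φ₂ φ₃ μ : ℝ) : TwoQubit :=
  ybTwo (braidGate l φ₁ φ₂ φ₃) (phase ((φ₂ + φ₃) / 2)) (phase φ₁) (exp μ : ℝ)

/-- `R_{l,3} = α(x, λ₂) B + γ(x, λ₁) B†` for `l = I, II`, up to the factor `x - 1`. -/
def gate3 (l : BraidLabel) (φ₁ φ₂ φ₃ μ : ℝ) : TwoQubit :=
  ybTwo (braidGate l φ₁ φ₂ φ₃) (phase φ₁) (-phase ((φ₂ + φ₃) / 2)) (exp μ : ℝ)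

/-- `R_{III,1}`; the eigenvalues of `B_III` are
`λ₁ = -e^{iφ₁}`, `λ₂ = e^{-iφ₁}`, `λ₃ = e^{iφ₁}`. -/
def gateIII1 (φ₁ φ₂ μ : ℝ) : TwoQubit :=
  ybThree (braidIII φ₁ φ₂) (-phase φ₁) (phase (-φ₁)) (phase φ₁) (exp μ : ℝ)

/-- `R_{III,2}`, up to the factor `x - 1`. -/
def gateIII2 (φ₁ φ₂ μ : ℝ) : TwoQubit :=
  ybTwo (braidIII φ₁ φ₂) (phase φ₁) (phase (-φ₁)) (exp μ : ℝ)

/-- `R_{III,3}`, up to the factor `x - 1`. -/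
def gateIII3 (φ₁ φ₂ μ : ℝ) : TwoQubit :=
  ybTwo (braidIII φ₁ φ₂) (phase (-φ₁)) (-phase φ₁) (exp μ : ℝ)

/-- `R_IV(χ)`. -/
def gateIV (φ₁ χ : ℝ) : TwoQubit :=
  ofBasis !![(cos χ : ℂ), 0, 0, phase φ₁ * sin χ;
             0, (cos χ : ℂ), (sin χ : ℂ), 0;
             0, -(sin χ : ℂ), (cos χ : ℂ), 0;
             -phase (-φ₁) * sin χ, 0, 0, (cos χ : ℂ)]

/-- `R_IV(χ)` is the Yang-Baxterization `B + x λ₁ λ₂ B†` of `B_IV` (here `λ₁ λ₂ = 1`) with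
`x = tan (π/4 - χ)`, multiplied by `cos (π/4 - χ)`. -/
theorem gateIV_eq (φ₁ χ : ℝ) :
    gateIV φ₁ χ = (cos (π / 4 - χ) : ℂ) • braidIV φ₁ + (sin (π / 4 - χ) : ℂ) • (braidIV φ₁)ᴴ := by
  have h2 : (√2 : ℂ) * (√2 : ℂ) = 2 := by
    rw [← Complex.ofReal_mul, Real.mul_self_sqrt (by norm_num)]
    norm_num
  have h0 : (√2 : ℂ) ≠ 0 := by
    intro h
    simp [h] at h2
  have hc : (cos (π / 4 - χ) : ℂ) = (cos χ + sin χ) / (√2 : ℂ) := by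
    rw [eq_div_iff h0, Real.cos_sub, Real.cos_pi_div_four, Real.sin_pi_div_four]
    push_cast
    linear_combination (Complex.cos χ + Complex.sin χ) / 2 * h2
  have hs : (sin (π / 4 - χ) : ℂ) = (cos χ - sin χ) / (√2 : ℂ) := by
    rw [eq_div_iff h0, Real.sin_sub, Real.cos_pi_div_four, Real.sin_pi_div_four]
    push_cast
    linear_combination (Complex.cos χ - Complex.sin χ) / 2 * h2
  have hp (θ : ℝ) : (starRingEnd ℂ) (phase θ) = phase (-θ) := by
    simp [phase, ← Complex.exp_conj]
  have key (z w v : ℂ) (h : z + w = 2 * v) :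
      z / (√2 : ℂ) * (1 / (√2 : ℂ)) + w / (√2 : ℂ) * (1 / (√2 : ℂ)) = v := by
    rw [div_mul_div_comm, div_mul_div_comm, h2, ← add_div]
    simp [h]
  rw [hc, hs]
  ext ⟨a, b⟩ ⟨c, d⟩
  fin_cases a <;> fin_cases b <;> fin_cases c <;> fin_cases d <;>
    simp [gateIV, braidIV, ofBasis, finProdFinEquiv, hp, Matrix.conjTranspose_apply] <;>
    field_simp <;> ring_nf <;> simp [pow_two, h2]

/-- `t` is an integer multiple of `s`. -/
def IsIntMul (t s : ℝ) : Prop := ∃ k : ℤ, t = k * s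

end

/-! Every gate in question is of X-type: it preserves the two parity sectors, spanned by |00⟩, |11⟩
and by |01⟩, |10⟩. Up to an overall scalar, each of its two blocks is `rot ε c s z`, a complex
factor ε times a real multiple of an SU(2) matrix with real diagonal entry c and off-diagonal entry
zs, |z| = 1. So the three properties need to be decided only once, for a pair of such blocks A, C
with the same norm.

Matchgate: the determinants are ε²(c² + s²) and ε'²(c'² + s'²), which have to agree. Dual-unitary:
reshuffling permutes entries between the blocks and yields another X-type operator, whose unitarity
is a norm condition together with the vanishing of cc' Re(ε ε̄') (`isDualUnitary_rot_iff`).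

Clifford: it suffices to conjugate X and Z on each qubit. The Z's preserve parity and the X's
exchange it, so the test concerns the 2×2 blocks AZA†, CZC†, AC† and AXC† (`isClifford_xType_iff`).
A Pauli block is diagonal or antidiagonal with fourth roots of unity as entries. Here AZA† has
diagonal ±(c² - s²) and off-diagonal modulus 2|cs|, so for normalized blocks either cs = c's' = 0 or
c² = s² and c'² = s'²; the remaining blocks then constrain z, z' and force the relative phase of ε
and ε' to be a fourth root of unity (`isClifford_rot_iff`). Since normalization and global phase are
free, everything is restated for unnormalized blocks through `IsRotPair`.

What remains is to recognize the parameters. For l = I, II one block is scalar, with factor sinh(μ +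
iφ), sinh((μ + iφ)/2) or cosh((μ + iφ)/2) for k = 1, 2, 3. For l = III the parameters are the real
and imaginary parts of sinh(μ/2 + iφ₁) and cosh(μ/2 + iφ₁). Each property becomes a real polynomial
equation in cos, sin, cosh and sinh, which translates back into conditions on the angles and into
the tanh equations. -/

/-! ### Block form of operators that preserve or exchange the parity sectors -/

/-- The X-type operator with block `A` on the span of `|00⟩, |11⟩` and block `C` on the span of
`|01⟩, |10⟩`. -/
def xType (A C : Matrix (Fin 2) (Fin 2) ℂ) : TwoQubit :=
  ofBasis !![A 0 0, 0, 0, A 0 1;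
             0, C 0 0, C 0 1, 0;
             0, C 1 0, C 1 1, 0;
             A 1 0, 0, 0, A 1 1]

/-- The operator that exchanges the spans of `|00⟩, |11⟩` and of `|01⟩, |10⟩`, with block `E` from
the second to the first and block `F` from the first to the second. -/
def oddType (E F : Matrix (Fin 2) (Fin 2) ℂ) : TwoQubit :=
  ofBasis !![0, E 0 0, E 0 1, 0;
             F 0 0, 0, 0, F 0 1;
             F 1 0, 0, 0, F 1 1;
             0, E 1 0, E 1 1, 0]

theorem ofBasis_eq_submatrix (M : Matrix (Fin 4) (Fin 4) ℂ) :
    ofBasis M = M.submatrix finProdFinEquiv finProdFinEquiv := rfl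

theorem ofBasis_mul (M N : Matrix (Fin 4) (Fin 4) ℂ) :
    ofBasis M * ofBasis N = ofBasis (M * N) := by
  simp only [ofBasis_eq_submatrix, Matrix.submatrix_mul_equiv]

theorem ofBasis_conjTranspose (M : Matrix (Fin 4) (Fin 4) ℂ) : (ofBasis M)ᴴ = ofBasis Mᴴ := rfl

theorem ofBasis_smul (c : ℂ) (M : Matrix (Fin 4) (Fin 4) ℂ) :
    c • ofBasis M = ofBasis (c • M) := rfl

theorem ofBasis_add (M N : Matrix (Fin 4) (Fin 4) ℂ) :
    ofBasis M + ofBasis N = ofBasis (M + N) := rfl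

theorem ofBasis_one : ofBasis 1 = 1 := by
  simp [ofBasis_eq_submatrix]

theorem ofBasis_injective : Function.Injective ofBasis := by
  intro M N h
  ext i j
  have := congrFun (congrFun h (finProdFinEquiv.symm i)) (finProdFinEquiv.symm j)
  simpa [ofBasis] using this

theorem xType_mul_xType (A C A' C' : Matrix (Fin 2) (Fin 2) ℂ) :
    xType A C * xType A' C' = xType (A * A') (C * C') := by
  rw [xType, xType, ofBasis_mul, xType]
  congr 1
  ext i j
  fin_cases i <;> fin_cases j <;> simp [Matrix.mul_apply, Fin.sum_univ_four]

theorem xType_mul_oddType (A C E F : Matrix (Fin 2) (Fin 2) ℂ) :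
    xType A C * oddType E F = oddType (A * E) (C * F) := by
  rw [xType, oddType, ofBasis_mul, oddType]
  congr 1
  ext i j
  fin_cases i <;> fin_cases j <;> simp [Matrix.mul_apply, Fin.sum_univ_four]

theorem oddType_mul_xType (A C E F : Matrix (Fin 2) (Fin 2) ℂ) :
    oddType E F * xType A C = oddType (E * C) (F * A) := by
  rw [xType, oddType, ofBasis_mul, oddType]
  congr 1
  ext i j
  fin_cases i <;> fin_cases j <;> simp [Matrix.mul_apply, Fin.sum_univ_four]

theorem xType_conjTranspose (A C : Matrix (Fin 2) (Fin 2) ℂ) : (xType A C)ᴴ = xType Aᴴ Cᴴ := by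
  rw [xType, ofBasis_conjTranspose, xType]
  congr 1
  ext i j
  fin_cases i <;> fin_cases j <;> simp

theorem smul_xType (k : ℂ) (A C : Matrix (Fin 2) (Fin 2) ℂ) :
    k • xType A C = xType (k • A) (k • C) := by
  rw [xType, ofBasis_smul, xType]
  congr 1
  ext i j
  fin_cases i <;> fin_cases j <;> simp

theorem xType_add (A C A' C' : Matrix (Fin 2) (Fin 2) ℂ) :
    xType A C + xType A' C' = xType (A + A') (C + C') := by
  rw [xType, xType, ofBasis_add, xType]
  congr 1
  ext i j
  fin_cases i <;> fin_cases j <;> simp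

theorem xType_one : xType 1 1 = 1 := by
  rw [xType, ← ofBasis_one]
  congr 1
  ext i j
  fin_cases i <;> fin_cases j <;> simp

theorem xType_zero : xType 0 0 = 0 := by
  have := smul_xType 0 0 0
  simpa using this.symm

theorem xType_inj {A C A' C' : Matrix (Fin 2) (Fin 2) ℂ} :
    xType A C = xType A' C' ↔ A = A' ∧ C = C' := by
  refine ⟨fun h => ?_, fun ⟨h, h'⟩ => h ▸ h' ▸ rfl⟩
  have h := ofBasis_injective h
  have e := fun i j => congrFun (congrFun h i) j
  have e00 := e 0 0
  have e03 := e 0 3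
  have e30 := e 3 0
  have e33 := e 3 3
  have e11 := e 1 1
  have e12 := e 1 2
  have e21 := e 2 1
  have e22 := e 2 2
  simp at e00 e03 e30 e33 e11 e12 e21 e22
  constructor <;> ext i j <;> fin_cases i <;> fin_cases j <;> simpa

theorem mem_unitaryGroup_iff_xType {A C : Matrix (Fin 2) (Fin 2) ℂ} :
    xType A C ∈ Matrix.unitaryGroup (Fin 2 × Fin 2) ℂ ↔ A * Aᴴ = 1 ∧ C * Cᴴ = 1 := by
  rw [Matrix.mem_unitaryGroup_iff, Matrix.star_eq_conjTranspose, xType_conjTranspose,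
    xType_mul_xType, ← xType_one, xType_inj]

/-- The reshuffling is a permutation of matrix entries that respects total parity, so dual-unitarity
of an X-type gate is again a question about two 2×2 blocks. The diagonal entries of both blocks form
one new block, the off-diagonal entries the other. -/
theorem dualOp_xType (A C : Matrix (Fin 2) (Fin 2) ℂ) :
    dualOp (xType A C) =
      xType !![A 0 0, C 1 1; C 0 0, A 1 1] !![A 1 0, C 0 1; C 1 0, A 0 1] := by
  ext ⟨a, b⟩ ⟨c, d⟩
  fin_cases a <;> fin_cases b <;> fin_cases c <;> fin_cases d <;>
    simp [dualOp, xType, ofBasis, finProdFinEquiv]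

/-! ### The Pauli group in block form -/

theorem one_mem_pauliGroup : (1 : TwoQubit) ∈ pauliGroup :=
  ⟨0, 0, 0, by simp [pauli]⟩

theorem pauli_mul (a b : Fin 4) :
    ∃ (k : Fin 4) (c : Fin 4), pauli a * pauli b = Complex.I ^ (k : ℕ) • pauli c := by
  fin_cases a <;> fin_cases b
  · exact ⟨0, 0, by simp [pauli]⟩
  · exact ⟨0, 1, by simp [pauli]⟩
  · exact ⟨0, 2, by simp [pauli]⟩
  · exact ⟨0, 3, by simp [pauli]⟩
  · exact ⟨0, 1, by simp [pauli]⟩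
  · exact ⟨0, 0, by simp [pauli, Matrix.one_fin_two]⟩
  · exact ⟨1, 3, by simp [pauli]⟩
  · exact ⟨3, 2, by simp [pauli, Complex.I_pow_three]⟩
  · exact ⟨0, 2, by simp [pauli]⟩
  · exact ⟨3, 3, by simp [pauli, Complex.I_pow_three]⟩
  · exact ⟨0, 0, by simp [pauli, Matrix.one_fin_two]⟩
  · exact ⟨1, 1, by simp [pauli]⟩
  · exact ⟨0, 3, by simp [pauli]⟩
  · exact ⟨1, 2, by simp [pauli]⟩
  · exact ⟨3, 1, by simp [pauli, Complex.I_pow_three]⟩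
  · exact ⟨0, 0, by simp [pauli, Matrix.one_fin_two]⟩

theorem I_pow_smul_mem_pauliGroup (k : ℕ) (a b : Fin 4) :
    Complex.I ^ k • (pauli a ⊗ₖ pauli b) ∈ pauliGroup := by
  refine ⟨⟨k % 4, Nat.mod_lt _ (by norm_num)⟩, a, b, ?_⟩
  rw [Complex.I_pow_eq_pow_mod]

theorem mul_mem_pauliGroup {P Q : TwoQubit} (hP : P ∈ pauliGroup) (hQ : Q ∈ pauliGroup) :
    P * Q ∈ pauliGroup := by
  obtain ⟨k, a, b, rfl⟩ := hP
  obtain ⟨k', a', b', rfl⟩ := hQ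
  obtain ⟨m, c, hc⟩ := pauli_mul a a'
  obtain ⟨m', c', hc'⟩ := pauli_mul b b'
  rw [smul_mul_smul_comm, ← Matrix.mul_kronecker_mul, hc, hc', Matrix.smul_kronecker,
    Matrix.kronecker_smul, smul_smul, smul_smul, ← pow_add, ← pow_add, ← pow_add]
  exact I_pow_smul_mem_pauliGroup _ _ _

theorem I_pow_smul_mem {P : TwoQubit} (k : ℕ) (hP : P ∈ pauliGroup) :
    Complex.I ^ k • P ∈ pauliGroup := by
  obtain ⟨k', a, b, rfl⟩ := hP
  rw [smul_smul, ← pow_add]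
  exact I_pow_smul_mem_pauliGroup _ _ _

/-- The entries of an even or odd Pauli operator with blocks `V`, `W`: both blocks are diagonal or
both are antidiagonal, and the nonzero entries are fourth roots of unity that agree up to signs
given by a character. -/
def PauliBlocks (V W : Matrix (Fin 2) (Fin 2) ℂ) : Prop :=
  ∃ u σ τ : ℂ, u ^ 4 = 1 ∧ σ ^ 2 = 1 ∧ τ ^ 2 = 1 ∧
    ((V = !![u, 0; 0, u * σ * τ] ∧ W = !![u * τ, 0; 0, u * σ]) ∨
      (V = !![0, u; u * σ * τ, 0] ∧ W = !![0, u * τ; u * σ, 0]))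

theorem pow_four_eq_one_cases {u : ℂ} (h : u ^ 4 = 1) :
    u = 1 ∨ u = -1 ∨ u = Complex.I ∨ u = -Complex.I := by
  have : (u - 1) * ((u + 1) * ((u - Complex.I) * (u + Complex.I))) = 0 := by
    linear_combination h - (u ^ 2 - 1) * Complex.I_sq
  rcases mul_eq_zero.1 this with h | h
  · exact .inl (sub_eq_zero.1 h)
  rcases mul_eq_zero.1 h with h | h
  · exact .inr (.inl (eq_neg_of_add_eq_zero_left h))
  rcases mul_eq_zero.1 h with h | h
  · exact .inr (.inr (.inl (sub_eq_zero.1 h)))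
  · exact .inr (.inr (.inr (eq_neg_of_add_eq_zero_left h)))

theorem exists_I_pow {u : ℂ} (h : u ^ 4 = 1) : ∃ k : ℕ, u = Complex.I ^ k := by
  rcases pow_four_eq_one_cases h with rfl | rfl | rfl | rfl
  · exact ⟨0, by simp⟩
  · exact ⟨2, by simp⟩
  · exact ⟨1, by simp⟩
  · exact ⟨3, by simp [Complex.I_pow_three]⟩

theorem exists_pauli_smul_diag {σ : ℂ} (h : σ ^ 2 = 1) :
    ∃ (k : ℕ) (a : Fin 4), Complex.I ^ k • pauli a = !![1, 0; 0, σ] := by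
  rcases (by simpa using h : σ = 1 ∨ σ = -1) with rfl | rfl
  · exact ⟨0, 0, by simp [pauli, Matrix.one_fin_two]⟩
  · exact ⟨0, 3, by simp [pauli]⟩

theorem exists_pauli_smul_antidiag {σ : ℂ} (h : σ ^ 2 = 1) :
    ∃ (k : ℕ) (a : Fin 4), Complex.I ^ k • pauli a = !![0, 1; σ, 0] := by
  rcases (by simpa using h : σ = 1 ∨ σ = -1) with rfl | rfl
  · exact ⟨0, 1, by simp [pauli]⟩
  · exact ⟨1, 2, by simp [pauli]⟩

theorem smul_kronecker_mem_pauliGroup {u : ℂ} (hu : u ^ 4 = 1) {S T : Matrix (Fin 2) (Fin 2) ℂ}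
    (hS : ∃ (k : ℕ) (a : Fin 4), Complex.I ^ k • pauli a = S)
    (hT : ∃ (k : ℕ) (a : Fin 4), Complex.I ^ k • pauli a = T) :
    u • (S ⊗ₖ T) ∈ pauliGroup := by
  obtain ⟨m, rfl⟩ := exists_I_pow hu
  obtain ⟨k, a, rfl⟩ := hS
  obtain ⟨k', b, rfl⟩ := hT
  rw [Matrix.smul_kronecker, Matrix.kronecker_smul, smul_smul, smul_smul, ← pow_add, ← pow_add]
  exact I_pow_smul_mem_pauliGroup _ _ _

theorem PauliBlocks.xType_mem {V W : Matrix (Fin 2) (Fin 2) ℂ} (h : PauliBlocks V W) :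
    xType V W ∈ pauliGroup := by
  obtain ⟨u, σ, τ, hu, hσ, hτ, ⟨rfl, rfl⟩ | ⟨rfl, rfl⟩⟩ := h
  · convert smul_kronecker_mem_pauliGroup hu (exists_pauli_smul_diag hσ)
      (exists_pauli_smul_diag hτ) using 1
    ext ⟨a, b⟩ ⟨c, d⟩
    fin_cases a <;> fin_cases b <;> fin_cases c <;> fin_cases d <;>
      simp [xType, ofBasis, finProdFinEquiv, mul_assoc]
  · convert smul_kronecker_mem_pauliGroup hu (exists_pauli_smul_antidiag hσ)
      (exists_pauli_smul_antidiag hτ) using 1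
    ext ⟨a, b⟩ ⟨c, d⟩
    fin_cases a <;> fin_cases b <;> fin_cases c <;> fin_cases d <;>
      simp [xType, ofBasis, finProdFinEquiv, mul_assoc]

theorem PauliBlocks.oddType_mem {V W : Matrix (Fin 2) (Fin 2) ℂ} (h : PauliBlocks V W) :
    oddType V W ∈ pauliGroup := by
  obtain ⟨u, σ, τ, hu, hσ, hτ, ⟨rfl, rfl⟩ | ⟨rfl, rfl⟩⟩ := h
  · convert smul_kronecker_mem_pauliGroup hu (exists_pauli_smul_diag hσ)
      (exists_pauli_smul_antidiag hτ) using 1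
    ext ⟨a, b⟩ ⟨c, d⟩
    fin_cases a <;> fin_cases b <;> fin_cases c <;> fin_cases d <;>
      simp [oddType, ofBasis, finProdFinEquiv, mul_assoc]
  · convert smul_kronecker_mem_pauliGroup hu (exists_pauli_smul_antidiag hσ)
      (exists_pauli_smul_diag hτ) using 1
    ext ⟨a, b⟩ ⟨c, d⟩
    fin_cases a <;> fin_cases b <;> fin_cases c <;> fin_cases d <;>
      simp [oddType, ofBasis, finProdFinEquiv, mul_assoc]

theorem pauli_eq_diag_or_antidiag (a : Fin 4) :
    ∃ v σ : ℂ, v ^ 4 = 1 ∧ σ ^ 2 = 1 ∧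
      (pauli a = v • !![1, 0; 0, σ] ∨ pauli a = v • !![0, 1; σ, 0]) := by
  fin_cases a
  · exact ⟨1, 1, by simp, by simp, .inl (by simp [pauli, Matrix.one_fin_two])⟩
  · exact ⟨1, 1, by simp, by simp, .inr (by simp [pauli])⟩
  · exact ⟨-Complex.I, -1, by simp [Even.neg_pow (by decide : Even 4)], by simp, .inr (by simp [pauli])⟩
  · exact ⟨1, -1, by simp, by simp, .inl (by simp [pauli])⟩

/-- Each tensor factor is diagonal or antidiagonal. The product preserves parity when both factors
are of the same kind and exchanges it otherwise. -/
theorem exists_pauliBlocks {P : TwoQubit} (hP : P ∈ pauliGroup) :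
    ∃ V W, PauliBlocks V W ∧ (P = xType V W ∨ P = oddType V W) := by
  obtain ⟨k, a, b, rfl⟩ := hP
  obtain ⟨v, σ, hv, hσ, ha⟩ := pauli_eq_diag_or_antidiag a
  obtain ⟨w, τ, hw, hτ, hb⟩ := pauli_eq_diag_or_antidiag b
  have hu : (Complex.I ^ (k : ℕ) * v * w) ^ 4 = 1 := by
    rw [mul_pow, mul_pow, hv, hw, ← pow_mul, mul_comm (k : ℕ), pow_mul, Complex.I_pow_four]
    simp
  generalize Complex.I ^ (k : ℕ) = i at hu ⊢
  rcases ha with ha | ha <;> rcases hb with hb | hb <;> rw [ha, hb]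
  · refine ⟨_, _, ⟨i * v * w, σ, τ, hu, hσ, hτ, .inl ⟨rfl, rfl⟩⟩, .inl ?_⟩
    ext ⟨a, b⟩ ⟨c, d⟩
    fin_cases a <;> fin_cases b <;> fin_cases c <;> fin_cases d <;>
      simp [xType, ofBasis, finProdFinEquiv] <;> ring
  · refine ⟨_, _, ⟨i * v * w, σ, τ, hu, hσ, hτ, .inl ⟨rfl, rfl⟩⟩, .inr ?_⟩
    ext ⟨a, b⟩ ⟨c, d⟩
    fin_cases a <;> fin_cases b <;> fin_cases c <;> fin_cases d <;>
      simp [oddType, ofBasis, finProdFinEquiv] <;> ring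
  · refine ⟨_, _, ⟨i * v * w, σ, τ, hu, hσ, hτ, .inr ⟨rfl, rfl⟩⟩, .inr ?_⟩
    ext ⟨a, b⟩ ⟨c, d⟩
    fin_cases a <;> fin_cases b <;> fin_cases c <;> fin_cases d <;>
      simp [oddType, ofBasis, finProdFinEquiv] <;> ring
  · refine ⟨_, _, ⟨i * v * w, σ, τ, hu, hσ, hτ, .inr ⟨rfl, rfl⟩⟩, .inl ?_⟩
    ext ⟨a, b⟩ ⟨c, d⟩
    fin_cases a <;> fin_cases b <;> fin_cases c <;> fin_cases d <;>
      simp [xType, ofBasis, finProdFinEquiv] <;> ring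

theorem PauliBlocks.ne_zero {V W : Matrix (Fin 2) (Fin 2) ℂ} (h : PauliBlocks V W) : V ≠ 0 := by
  obtain ⟨u, σ, τ, hu, -, -, ⟨rfl, rfl⟩ | ⟨rfl, rfl⟩⟩ := h <;> intro h0
  · have := congrFun (congrFun h0 0) 0
    simp at this
    simp [this] at hu
  · have := congrFun (congrFun h0 0) 1
    simp at this
    simp [this] at hu

theorem oddType_inj {E F E' F' : Matrix (Fin 2) (Fin 2) ℂ} (h : oddType E F = oddType E' F') :
    E = E' ∧ F = F' := by
  have h := ofBasis_injective h
  have e := fun i j => congrFun (congrFun h i) j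
  have e01 := e 0 1
  have e02 := e 0 2
  have e31 := e 3 1
  have e32 := e 3 2
  have e10 := e 1 0
  have e13 := e 1 3
  have e20 := e 2 0
  have e23 := e 2 3
  simp at e01 e02 e31 e32 e10 e13 e20 e23
  constructor <;> ext i j <;> fin_cases i <;> fin_cases j <;> simpa

theorem eq_zero_of_xType_eq_oddType {A C E F : Matrix (Fin 2) (Fin 2) ℂ}
    (h : xType A C = oddType E F) : A = 0 ∧ E = 0 := by
  have h := ofBasis_injective h
  have e := fun i j => congrFun (congrFun h i) j
  have e00 := e 0 0
  have e03 := e 0 3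
  have e30 := e 3 0
  have e33 := e 3 3
  have e01 := e 0 1
  have e02 := e 0 2
  have e31 := e 3 1
  have e32 := e 3 2
  simp at e00 e03 e30 e33 e01 e02 e31 e32
  constructor <;> ext i j <;> fin_cases i <;> fin_cases j <;> simp [e00, e03, e30, e33, ← e01, ← e02, ← e31, ← e32]

/-- A Pauli operator has nonzero blocks, so an even operator cannot equal an odd Pauli, and the
blocks of an even one are determined by the operator. -/
theorem xType_mem_pauliGroup_iff {V W : Matrix (Fin 2) (Fin 2) ℂ} :
    xType V W ∈ pauliGroup ↔ PauliBlocks V W := by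
  refine ⟨fun h => ?_, fun h => h.xType_mem⟩
  obtain ⟨V', W', h', e | e⟩ := exists_pauliBlocks h
  · obtain ⟨rfl, rfl⟩ := xType_inj.1 e
    exact h'
  · exact absurd (eq_zero_of_xType_eq_oddType e).2 h'.ne_zero

theorem oddType_mem_pauliGroup_iff {V W : Matrix (Fin 2) (Fin 2) ℂ} :
    oddType V W ∈ pauliGroup ↔ PauliBlocks V W := by
  refine ⟨fun h => ?_, fun h => h.oddType_mem⟩
  obtain ⟨V', W', h', e | e⟩ := exists_pauliBlocks h
  · exact absurd (eq_zero_of_xType_eq_oddType e.symm).1 h'.ne_zero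
  · obtain ⟨rfl, rfl⟩ := oddType_inj e
    exact h'

/-- Negating the second block of an even operator is multiplication by Z ⊗ Z, which flips both signs
of the character. This derives the condition for 1 ⊗ Z from that for Z ⊗ 1. -/
theorem PauliBlocks.neg_right {V W : Matrix (Fin 2) (Fin 2) ℂ} (h : PauliBlocks V W) :
    PauliBlocks V (-W) := by
  obtain ⟨u, σ, τ, hu, hσ, hτ, h⟩ := h
  refine ⟨u, -σ, -τ, hu, by simpa only [neg_sq], by simpa only [neg_sq], ?_⟩
  rcases h with ⟨rfl, rfl⟩ | ⟨rfl, rfl⟩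
  · left; constructor <;> ext i j <;> fin_cases i <;> fin_cases j <;> simp
  · right; constructor <;> ext i j <;> fin_cases i <;> fin_cases j <;> simp

/-- Elimination of the existential signs: σ and τ are ratios of entries, so membership becomes a
list of polynomial identities that can be checked on explicit matrices. -/
theorem pauliBlocks_iff {V W : Matrix (Fin 2) (Fin 2) ℂ} :
    PauliBlocks V W ↔
      ((V 0 1 = 0 ∧ V 1 0 = 0 ∧ W 0 1 = 0 ∧ W 1 0 = 0) ∧ V 0 0 ^ 4 = 1 ∧ V 1 1 ^ 2 = V 0 0 ^ 2 ∧
        W 0 0 ^ 2 = V 0 0 ^ 2 ∧ W 1 1 * V 0 0 = V 1 1 * W 0 0) ∨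
      ((V 0 0 = 0 ∧ V 1 1 = 0 ∧ W 0 0 = 0 ∧ W 1 1 = 0) ∧ V 0 1 ^ 4 = 1 ∧ V 1 0 ^ 2 = V 0 1 ^ 2 ∧
        W 0 1 ^ 2 = V 0 1 ^ 2 ∧ W 1 0 * V 0 1 = V 1 0 * W 0 1) := by
  constructor
  · rintro ⟨u, σ, τ, hu, hσ, hτ, ⟨rfl, rfl⟩ | ⟨rfl, rfl⟩⟩
    · left
      simp only [Matrix.cons_val_zero, Matrix.cons_val_one, Matrix.of_apply, Matrix.cons_val',
        Matrix.cons_val_fin_one, and_self, true_and]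
      exact ⟨hu, by linear_combination u ^ 2 * τ ^ 2 * hσ + u ^ 2 * hτ,
        by linear_combination u ^ 2 * hτ, by linear_combination -(u ^ 2 * σ) * hτ⟩
    · right
      simp only [Matrix.cons_val_zero, Matrix.cons_val_one, Matrix.of_apply, Matrix.cons_val',
        Matrix.cons_val_fin_one, and_self, true_and]
      exact ⟨hu, by linear_combination u ^ 2 * τ ^ 2 * hσ + u ^ 2 * hτ,
        by linear_combination u ^ 2 * hτ, by linear_combination -(u ^ 2 * σ) * hτ⟩
  · have key (a b c d : ℂ) (ha : a ^ 4 = 1) (hb : b ^ 2 = a ^ 2) (hc : c ^ 2 = a ^ 2)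
        (hd : d * a = b * c) : ∃ σ τ : ℂ, σ ^ 2 = 1 ∧ τ ^ 2 = 1 ∧
          b = a * σ * τ ∧ c = a * τ ∧ d = a * σ := by
      have h0 : a ≠ 0 := by rintro rfl; simp at ha
      refine ⟨d / a, c / a, ?_, ?_, ?_, ?_, ?_⟩
      · rw [div_pow, div_eq_one_iff_eq (pow_ne_zero _ h0)]
        apply mul_right_cancel₀ (pow_ne_zero 2 h0)
        linear_combination (d * a + b * c) * hd + c ^ 2 * hb + a ^ 2 * hc
      · rw [div_pow, hc, div_self (pow_ne_zero _ h0)]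
      · field_simp
        apply mul_right_cancel₀ h0
        linear_combination -c * hd - b * hc
      · field_simp
      · field_simp
    rintro (⟨⟨h1, h2, h3, h4⟩, ha, hb, hc, hd⟩ | ⟨⟨h1, h2, h3, h4⟩, ha, hb, hc, hd⟩)
    · obtain ⟨σ, τ, hσ, hτ, e1, e2, e3⟩ := key _ _ _ _ ha hb hc hd
      refine ⟨V 0 0, σ, τ, ha, hσ, hτ, .inl ⟨?_, ?_⟩⟩
      · rw [← e1]; ext i j; fin_cases i <;> fin_cases j <;> simp [*]
      · rw [← e2, ← e3]; ext i j; fin_cases i <;> fin_cases j <;> simp [*]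
    · obtain ⟨σ, τ, hσ, hτ, e1, e2, e3⟩ := key _ _ _ _ ha hb hc hd
      refine ⟨V 0 1, σ, τ, ha, hσ, hτ, .inr ⟨?_, ?_⟩⟩
      · rw [← e1]; ext i j; fin_cases i <;> fin_cases j <;> simp [*]
      · rw [← e2, ← e3]; ext i j; fin_cases i <;> fin_cases j <;> simp [*]

theorem conj_eq_pow_three {u : ℂ} (h : u ^ 4 = 1) : (starRingEnd ℂ) u = u ^ 3 := by
  rcases pow_four_eq_one_cases h with rfl | rfl | rfl | rfl <;>
    simp [Odd.neg_pow (by decide : Odd 3), Complex.I_pow_three]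

/-- The image of a Hermitian odd operator has blocks V and V†. For fourth roots of unity conjugation
is cubing, so all conditions on the second block follow from those on V. -/
theorem pauliBlocks_conjTranspose_iff {V : Matrix (Fin 2) (Fin 2) ℂ} :
    PauliBlocks V Vᴴ ↔
      ((V 0 1 = 0 ∧ V 1 0 = 0) ∧ V 0 0 ^ 4 = 1 ∧ V 1 1 ^ 2 = V 0 0 ^ 2) ∨
      ((V 0 0 = 0 ∧ V 1 1 = 0) ∧ V 0 1 ^ 4 = 1 ∧ V 1 0 ^ 2 = V 0 1 ^ 2) := by
  rw [pauliBlocks_iff]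
  simp only [Matrix.conjTranspose_apply, RCLike.star_def, map_eq_zero]
  constructor
  · rintro (⟨⟨h1, h2, -⟩, ha, hb, -⟩ | ⟨⟨h1, h2, -⟩, ha, hb, -⟩)
    · exact .inl ⟨⟨h1, h2⟩, ha, hb⟩
    · exact .inr ⟨⟨h1, h2⟩, ha, hb⟩
  · have h4 {a b : ℂ} (ha : a ^ 4 = 1) (hb : b ^ 2 = a ^ 2) : b ^ 4 = 1 := by
      linear_combination (b ^ 2 + a ^ 2) * hb + ha
    rintro (⟨⟨h1, h2⟩, ha, hb⟩ | ⟨⟨h1, h2⟩, ha, hb⟩)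
    · refine .inl ⟨⟨h1, h2, h2, h1⟩, ha, hb, ?_, ?_⟩
      · rw [conj_eq_pow_three ha]; linear_combination V 0 0 ^ 2 * ha
      · rw [conj_eq_pow_three ha, conj_eq_pow_three (h4 ha hb)]
        linear_combination V 0 0 * V 1 1 * hb
    · refine .inr ⟨⟨h1, h2, h1, h2⟩, ha, hb, ?_, ?_⟩
      · rw [conj_eq_pow_three (h4 ha hb)]
        linear_combination (V 1 0 ^ 4 + V 1 0 ^ 2 * V 0 1 ^ 2 + V 0 1 ^ 4) * hb + V 0 1 ^ 2 * ha
      · rw [conj_eq_pow_three ha, conj_eq_pow_three (h4 ha hb)]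
        linear_combination ha - h4 ha hb

/-! ### Clifford gates of X-type -/

/-- Conjugation by a unitary is multiplicative, and X and Z on each qubit generate the Pauli group
together with i, because Y = iXZ. -/
theorem isClifford_of_generators {U : TwoQubit} (hU : U ∈ Matrix.unitaryGroup (Fin 2 × Fin 2) ℂ)
    (h : ∀ a : Fin 4, (a = 1 ∨ a = 3) →
      U * (pauli a ⊗ₖ 1) * Uᴴ ∈ pauliGroup ∧ U * (1 ⊗ₖ pauli a) * Uᴴ ∈ pauliGroup) :
    IsClifford U := by
  have hU1 : Uᴴ * U = 1 := Matrix.mem_unitaryGroup_iff'.1 hU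
  have hU2 : U * Uᴴ = 1 := Matrix.mem_unitaryGroup_iff.1 hU
  have hmul {P Q : TwoQubit} (hP : U * P * Uᴴ ∈ pauliGroup) (hQ : U * Q * Uᴴ ∈ pauliGroup) :
      U * (P * Q) * Uᴴ ∈ pauliGroup := by
    have e : U * (P * Q) * Uᴴ = (U * P * Uᴴ) * (U * Q * Uᴴ) := by
      calc U * (P * Q) * Uᴴ = U * P * 1 * Q * Uᴴ := by simp only [mul_one, mul_assoc]
        _ = _ := by rw [← hU1]; simp only [mul_assoc]
    rw [e]
    exact mul_mem_pauliGroup hP hQ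
  have hY : pauli 2 = Complex.I ^ 1 • (pauli 1 * pauli 3) := by simp [pauli]
  have hsm {P : TwoQubit} (k : ℕ) (hP : U * P * Uᴴ ∈ pauliGroup) :
      U * (Complex.I ^ k • P) * Uᴴ ∈ pauliGroup := by
    rw [Matrix.mul_smul, Matrix.smul_mul]
    exact I_pow_smul_mem k hP
  have h1 (a : Fin 4) : U * (pauli a ⊗ₖ 1) * Uᴴ ∈ pauliGroup := by
    obtain rfl | rfl | rfl | rfl : a = 0 ∨ a = 1 ∨ a = 2 ∨ a = 3 := by omega
    · simpa [pauli, hU2] using one_mem_pauliGroup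
    · exact (h 1 (by simp)).1
    · rw [hY, Matrix.smul_kronecker]
      apply hsm
      rw [← mul_one (1 : Matrix (Fin 2) (Fin 2) ℂ), Matrix.mul_kronecker_mul]
      exact hmul (h 1 (by simp)).1 (h 3 (by simp)).1
    · exact (h 3 (by simp)).1
  have h2 (a : Fin 4) : U * (1 ⊗ₖ pauli a) * Uᴴ ∈ pauliGroup := by
    obtain rfl | rfl | rfl | rfl : a = 0 ∨ a = 1 ∨ a = 2 ∨ a = 3 := by omega
    · simpa [pauli, hU2] using one_mem_pauliGroup
    · exact (h 1 (by simp)).2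
    · rw [hY, Matrix.kronecker_smul]
      apply hsm
      rw [← mul_one (1 : Matrix (Fin 2) (Fin 2) ℂ), Matrix.mul_kronecker_mul]
      exact hmul (h 1 (by simp)).2 (h 3 (by simp)).2
    · exact (h 3 (by simp)).2
  refine ⟨hU, ?_⟩
  rintro _ ⟨k, a, b, rfl⟩
  apply hsm
  have : pauli a ⊗ₖ pauli b = (pauli a ⊗ₖ 1) * (1 ⊗ₖ pauli b) := by
    rw [← Matrix.mul_kronecker_mul, mul_one, one_mul]
  rw [this]
  exact hmul (h1 a) (h2 b)

theorem pauli_one_kronecker_one : pauli 1 ⊗ₖ 1 = oddType (pauli 1) (pauli 1) := by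
  ext ⟨a, b⟩ ⟨c, d⟩
  fin_cases a <;> fin_cases b <;> fin_cases c <;> fin_cases d <;>
    simp [oddType, ofBasis, finProdFinEquiv, pauli]

theorem one_kronecker_pauli_one : 1 ⊗ₖ pauli 1 = oddType 1 1 := by
  ext ⟨a, b⟩ ⟨c, d⟩
  fin_cases a <;> fin_cases b <;> fin_cases c <;> fin_cases d <;>
    simp [oddType, ofBasis, finProdFinEquiv, pauli]

theorem pauli_three_kronecker_one : pauli 3 ⊗ₖ 1 = xType (pauli 3) (pauli 3) := by
  ext ⟨a, b⟩ ⟨c, d⟩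
  fin_cases a <;> fin_cases b <;> fin_cases c <;> fin_cases d <;>
    simp [xType, ofBasis, finProdFinEquiv, pauli]

theorem one_kronecker_pauli_three : 1 ⊗ₖ pauli 3 = xType (pauli 3) (-pauli 3) := by
  ext ⟨a, b⟩ ⟨c, d⟩
  fin_cases a <;> fin_cases b <;> fin_cases c <;> fin_cases d <;>
    simp [xType, ofBasis, finProdFinEquiv, pauli]

theorem kronecker_pauli_mem (a b : Fin 4) : pauli a ⊗ₖ pauli b ∈ pauliGroup := by
  simpa using I_pow_smul_mem_pauliGroup 0 a b

theorem isClifford_xType_iff {A C : Matrix (Fin 2) (Fin 2) ℂ}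
    (hA : A * Aᴴ = 1) (hC : C * Cᴴ = 1) :
    IsClifford (xType A C) ↔
      PauliBlocks (A * pauli 3 * Aᴴ) (C * pauli 3 * Cᴴ) ∧
      PauliBlocks (A * Cᴴ) (A * Cᴴ)ᴴ ∧
      PauliBlocks (A * pauli 1 * Cᴴ) (A * pauli 1 * Cᴴ)ᴴ := by
  have hX : (pauli 1)ᴴ = pauli 1 := by
    ext i j; fin_cases i <;> fin_cases j <;> simp [pauli]
  have e1 : (A * Cᴴ)ᴴ = C * Aᴴ := by simp [Matrix.conjTranspose_mul]
  have e2 : (A * pauli 1 * Cᴴ)ᴴ = C * pauli 1 * Aᴴ := by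
    simp [Matrix.conjTranspose_mul, hX, mul_assoc]
  rw [e1, e2]
  have f1 : xType A C * (pauli 1 ⊗ₖ 1) * (xType A C)ᴴ =
      oddType (A * pauli 1 * Cᴴ) (C * pauli 1 * Aᴴ) := by
    rw [pauli_one_kronecker_one, xType_mul_oddType, xType_conjTranspose, oddType_mul_xType]
  have f2 : xType A C * (1 ⊗ₖ pauli 1) * (xType A C)ᴴ = oddType (A * Cᴴ) (C * Aᴴ) := by
    rw [one_kronecker_pauli_one, xType_mul_oddType, xType_conjTranspose, oddType_mul_xType,
      mul_one, mul_one]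
  have f3 : xType A C * (pauli 3 ⊗ₖ 1) * (xType A C)ᴴ =
      xType (A * pauli 3 * Aᴴ) (C * pauli 3 * Cᴴ) := by
    rw [pauli_three_kronecker_one, xType_mul_xType, xType_conjTranspose, xType_mul_xType]
  have f4 : xType A C * (1 ⊗ₖ pauli 3) * (xType A C)ᴴ =
      xType (A * pauli 3 * Aᴴ) (-(C * pauli 3 * Cᴴ)) := by
    rw [one_kronecker_pauli_three, xType_mul_xType, xType_conjTranspose, xType_mul_xType,
      mul_neg, neg_mul]
  constructor
  · rintro ⟨-, h⟩
    refine ⟨?_, ?_, ?_⟩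
    · rw [← xType_mem_pauliGroup_iff, ← f3]
      exact h _ (kronecker_pauli_mem 3 0)
    · rw [← oddType_mem_pauliGroup_iff, ← f2]
      exact h _ (kronecker_pauli_mem 0 1)
    · rw [← oddType_mem_pauliGroup_iff, ← f1]
      exact h _ (kronecker_pauli_mem 1 0)
  · rintro ⟨h1, h2, h3⟩
    refine isClifford_of_generators (mem_unitaryGroup_iff_xType.2 ⟨hA, hC⟩) ?_
    rintro a (rfl | rfl)
    · rw [f1, f2]
      exact ⟨h3.oddType_mem, h2.oddType_mem⟩
    · rw [f3, f4]
      exact ⟨h1.xType_mem, h1.neg_right.xType_mem⟩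

/-! ### X-type gates with blocks in `U(2)` -/

open scoped ComplexConjugate

/-- A multiple of the `SU(2)` matrix with real diagonal entry `c` and off-diagonal modulus `s`. -/
def rot (ε : ℂ) (c s : ℝ) (z : ℂ) : Matrix (Fin 2) (Fin 2) ℂ :=
  !![ε * c, ε * (z * s); -(ε * (conj z * s)), ε * c]

theorem rot_mul_conjTranspose (ε : ℂ) (c s : ℝ) {z : ℂ} (hz : z * conj z = 1) :
    rot ε c s z * (rot ε c s z)ᴴ =
      ((Complex.normSq ε * (c ^ 2 + s ^ 2) : ℝ) : ℂ) • (1 : Matrix (Fin 2) (Fin 2) ℂ) := by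
  have hε := Complex.mul_conj ε
  ext i j
  fin_cases i <;> fin_cases j <;>
    simp [rot, Matrix.mul_apply, Fin.sum_univ_two, ← hε]
  · linear_combination ε * conj ε * s ^ 2 * hz
  · ring
  · ring
  · linear_combination ε * conj ε * s ^ 2 * hz

theorem rot_mul_pauli_three_mul {ε : ℂ} (c s : ℝ) {z : ℂ} (hε : ε * conj ε = 1)
    (hz : z * conj z = 1) :
    rot ε c s z * pauli 3 * (rot ε c s z)ᴴ =
      !![(c : ℂ) ^ 2 - s ^ 2, -(2 * (c * s) * z); -(2 * (c * s) * conj z), s ^ 2 - c ^ 2] := by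
  ext i j
  fin_cases i <;> fin_cases j <;>
    simp [rot, Matrix.mul_apply, Fin.sum_univ_two, pauli]
  · linear_combination -(ε * conj ε * s ^ 2) * hz + (c ^ 2 - s ^ 2) * hε
  · linear_combination -(2 * (c * s) * z) * hε
  · linear_combination -(2 * (c * s) * conj z) * hε
  · linear_combination ε * conj ε * s ^ 2 * hz + (s ^ 2 - c ^ 2) * hε

theorem rot_mul_rot_conjTranspose (ε ε' : ℂ) (c s c' s' : ℝ) (z z' : ℂ) :
    rot ε c s z * (rot ε' c' s' z')ᴴ =
      !![ε * conj ε' * (c * c' + z * conj z' * (s * s')),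
        ε * conj ε' * (z * (s * c') - z' * (c * s'));
        ε * conj ε' * (conj z' * (c * s') - conj z * (s * c')),
        ε * conj ε' * (c * c' + conj z * z' * (s * s'))] := by
  ext i j
  fin_cases i <;> fin_cases j <;>
    simp [rot, Matrix.mul_apply, Fin.sum_univ_two] <;> ring

theorem rot_mul_pauli_one_mul (ε ε' : ℂ) (c s c' s' : ℝ) (z z' : ℂ) :
    rot ε c s z * pauli 1 * (rot ε' c' s' z')ᴴ =
      !![ε * conj ε' * (z * (s * c') + conj z' * (c * s')),
        ε * conj ε' * (c * c' - z * z' * (s * s'));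
        ε * conj ε' * (c * c' - conj z * conj z' * (s * s')),
        -(ε * conj ε' * (conj z * (s * c') + z' * (c * s')))] := by
  ext i j
  fin_cases i <;> fin_cases j <;>
    simp [rot, Matrix.mul_apply, Fin.sum_univ_two, pauli] <;> ring

/-- The condition on the blocks of an X-type gate, up to their relative phase, to be Clifford. -/
def CliffordRot (c s : ℝ) (z : ℂ) (c' s' : ℝ) (z' : ℂ) : Prop :=
  (s = 0 ∧ s' = 0) ∨ (s = 0 ∧ c' = 0 ∧ z' ^ 4 = 1) ∨ (c = 0 ∧ s' = 0 ∧ z ^ 4 = 1) ∨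
    (c = 0 ∧ c' = 0 ∧ (z * conj z') ^ 4 = 1 ∧ (z * z') ^ 4 = 1) ∨
    (c ^ 2 = s ^ 2 ∧ c' ^ 2 = s' ^ 2 ∧ z' ^ 2 = z ^ 2 ∧ z ^ 4 = 1)

/-- A real multiple of r that is a fourth root of unity puts r on one of the coordinate axes. The
real factor m stands for products of c, s, c', s', whose signs need not be tracked. -/
theorem re_mul_im_eq_zero_of_pow {r : ℂ} {m : ℝ} (h : (r * m) ^ 4 = 1) : r.re * r.im = 0 := by
  have hm : m ≠ 0 := by rintro rfl; simp at h
  have : (r * m).re * (r * m).im = 0 := by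
    rcases pow_four_eq_one_cases h with h | h | h | h <;> rw [h] <;> simp
  simp only [Complex.re_mul_ofReal, Complex.im_mul_ofReal] at this
  have h2 : r.re * r.im * m ^ 2 = 0 := by linear_combination this
  exact (mul_eq_zero.1 h2).resolve_right (pow_ne_zero _ hm)

/-- The hypothesis says that r² is real, that is, equal to its conjugate; on the unit circle this
gives r⁴ = r² r̄² = 1. -/
theorem pow_four_eq_one_of_re_mul_im {r : ℂ} (h1 : r * conj r = 1) (h : r.re * r.im = 0) :
    r ^ 4 = 1 := by
  have h2 : conj r ^ 2 = r ^ 2 := by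
    apply Complex.ext <;> simp [pow_two]
    linear_combination -4 * h
  linear_combination -r ^ 2 * h2 + (r * conj r + 1) * h1

theorem pow_four_eq_one_of_sq {r : ℂ} (h1 : r * conj r = 1) (h : conj r ^ 2 = r ^ 2) :
    r ^ 4 = 1 := by
  linear_combination -r ^ 2 * h + (r * conj r + 1) * h1

theorem conj_sq_of_pow_four {r : ℂ} (h : r ^ 4 = 1) : conj r ^ 2 = r ^ 2 := by
  rw [conj_eq_pow_three h]
  linear_combination r ^ 2 * h

/-- Only r = ε ε̄' enters the mixed blocks AC† and AXC†, while AZA† and CZC† do not see the factors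
at all. The cases of `CliffordRot` are the choices of which of c, s and c', s' vanish, plus the
balanced case c² = s², c'² = s'². -/
theorem isClifford_rot_iff {ε ε' z z' : ℂ} {c s c' s' : ℝ} (hε : ε * conj ε = 1)
    (hε' : ε' * conj ε' = 1) (hz : z * conj z = 1) (hz' : z' * conj z' = 1)
    (h : c ^ 2 + s ^ 2 = 1) (h' : c' ^ 2 + s' ^ 2 = 1) :
    IsClifford (xType (rot ε c s z) (rot ε' c' s' z')) ↔
      (ε * conj ε').re * (ε * conj ε').im = 0 ∧ CliffordRot c s z c' s' z' := by
  have hz0 : z ≠ 0 := by rintro rfl; simp at hz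
  have hz0' : z' ≠ 0 := by rintro rfl; simp at hz'
  have hn : Complex.normSq ε = 1 := by
    rw [Complex.mul_conj] at hε; exact_mod_cast hε
  have hn' : Complex.normSq ε' = 1 := by
    rw [Complex.mul_conj] at hε'; exact_mod_cast hε'
  rw [isClifford_xType_iff (by simp [rot_mul_conjTranspose _ _ _ hz, hn, h])
    (by simp [rot_mul_conjTranspose _ _ _ hz', hn', h']), rot_mul_pauli_three_mul _ _ hε hz,
    rot_mul_pauli_three_mul _ _ hε' hz', rot_mul_rot_conjTranspose, rot_mul_pauli_one_mul,
    pauliBlocks_iff, pauliBlocks_conjTranspose_iff, pauliBlocks_conjTranspose_iff]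
  have hr : ε * conj ε' * conj (ε * conj ε') = 1 := by
    simp only [map_mul, Complex.conj_conj]
    linear_combination conj ε' * ε' * hε + hε'
  generalize ε * conj ε' = r at hr ⊢
  have hr0 : r ≠ 0 := by rintro rfl; simp at hr
  have hC : (c : ℂ) ^ 2 + (s : ℂ) ^ 2 = 1 := by exact_mod_cast h
  have hC' : (c' : ℂ) ^ 2 + (s' : ℂ) ^ 2 = 1 := by exact_mod_cast h'
  simp only [Matrix.cons_val_zero, Matrix.cons_val_one, Matrix.of_apply, Matrix.cons_val',
        Matrix.cons_val_fin_one]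
  constructor
  · rintro ⟨h1, h2, h3⟩
    rcases h1 with ⟨⟨h1, -, h1', -⟩, -⟩ | ⟨⟨h1, -, h1', -⟩, hu, -, hv, -⟩
    · have e : c = 0 ∨ s = 0 := by simpa [hz0] using h1
      have e' : c' = 0 ∨ s' = 0 := by simpa [hz0'] using h1'
      rcases e with rfl | rfl <;> rcases e' with rfl | rfl <;>
        simp only [Complex.ofReal_zero, mul_zero, zero_mul, add_zero, zero_add, sub_zero, zero_sub,
          ne_eq, OfNat.ofNat_ne_zero, not_false_eq_true, zero_pow, zero_ne_one, false_and, and_false,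
          or_false, false_or, true_and, and_self, neg_zero] at h2 h3 hC hC'
      -- With c = c' = 0, AC† is diagonal with entries proportional to w = z z̄' and its conjugate.
      -- Equality of their squares makes w a fourth root of unity. The antidiagonal of AXC† does the
      -- same for zz'.
      · have ew : conj (z * conj z') ^ 2 = (z * conj z') ^ 2 := by
          simp only [map_mul, Complex.conj_conj]
          have : r ^ 2 * ((conj z * z') ^ 2 - (z * conj z') ^ 2) = 0 := by
            linear_combination h2.2 - r ^ 2 * ((conj z * z') ^ 2 - (z * conj z') ^ 2) *
              (s ^ 2 * hC' + hC)
          exact sub_eq_zero.1 ((mul_eq_zero.1 this).resolve_left (pow_ne_zero _ hr0))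
        have ew2 : conj (z * z') ^ 2 = (z * z') ^ 2 := by
          simp only [map_mul]
          have : r ^ 2 * ((conj z * conj z') ^ 2 - (z * z') ^ 2) = 0 := by
            linear_combination h3.2 - r ^ 2 * ((conj z * conj z') ^ 2 - (z * z') ^ 2) *
              (s ^ 2 * hC' + hC)
          exact sub_eq_zero.1 ((mul_eq_zero.1 this).resolve_left (pow_ne_zero _ hr0))
        have f1 := pow_four_eq_one_of_sq (r := z * conj z') (by
          simp only [map_mul, Complex.conj_conj]
          linear_combination z' * conj z' * hz + hz') ew
        have f2 := pow_four_eq_one_of_sq (r := z * z') (by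
          simp only [map_mul]
          linear_combination z' * conj z' * hz + hz') ew2
        refine ⟨re_mul_im_eq_zero_of_pow (m := s * s') ?_, .inr (.inr (.inr (.inl ⟨rfl, rfl, f1, f2⟩)))⟩
        push_cast
        linear_combination h2.1 - (r * (s * s')) ^ 4 * f1
      · have ew : conj z ^ 2 = z ^ 2 := by
          have : r ^ 2 * (conj z ^ 2 - z ^ 2) = 0 := by
            linear_combination h2.2 - r ^ 2 * (conj z ^ 2 - z ^ 2) * (s ^ 2 * hC' + hC)
          exact sub_eq_zero.1 ((mul_eq_zero.1 this).resolve_left (pow_ne_zero _ hr0))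
        have f1 := pow_four_eq_one_of_sq hz ew
        refine ⟨re_mul_im_eq_zero_of_pow (m := s * c') ?_, .inr (.inr (.inl ⟨rfl, rfl, f1⟩))⟩
        push_cast
        linear_combination h2.1 - (r * (s * c')) ^ 4 * f1
      · have ew : conj z' ^ 2 = z' ^ 2 := by
          have : r ^ 2 * (conj z' ^ 2 - z' ^ 2) = 0 := by
            linear_combination h2.2 - r ^ 2 * (conj z' ^ 2 - z' ^ 2) * (c ^ 2 * hC' + hC)
          exact sub_eq_zero.1 ((mul_eq_zero.1 this).resolve_left (pow_ne_zero _ hr0))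
        have f1 := pow_four_eq_one_of_sq hz' ew
        refine ⟨re_mul_im_eq_zero_of_pow (m := c * s') ?_, .inr (.inl ⟨rfl, rfl, f1⟩)⟩
        push_cast
        linear_combination h2.1 - (r * (c * s')) ^ 4 * f1
      · refine ⟨re_mul_im_eq_zero_of_pow (m := c * c') ?_, .inl ⟨rfl, rfl⟩⟩
        push_cast
        exact h2.1
    · have e : c ^ 2 = s ^ 2 := by exact_mod_cast sub_eq_zero.1 h1
      have e' : c' ^ 2 = s' ^ 2 := by exact_mod_cast sub_eq_zero.1 h1'
      have E : (c : ℂ) ^ 2 = s ^ 2 := by exact_mod_cast e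
      have E' : (c' : ℂ) ^ 2 = s' ^ 2 := by exact_mod_cast e'
      -- In the balanced case c² = s² = 1/2, so 2cs = ±1 and the antidiagonal entries of AZA† and
      -- CZC† are z and z' up to sign and conjugation.
      have d : (2 * ((c : ℂ) * s)) ^ 2 = 1 := by
        linear_combination (c ^ 2 + s ^ 2 + 1) * hC - (c ^ 2 - s ^ 2) * E
      have d' : (2 * ((c' : ℂ) * s')) ^ 2 = 1 := by
        linear_combination (c' ^ 2 + s' ^ 2 + 1) * hC' - (c' ^ 2 - s' ^ 2) * E'
      have f : z ^ 4 = 1 := by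
        linear_combination hu - z ^ 4 * ((2 * ((c : ℂ) * s)) ^ 2 + 1) * d
      have f' : z' ^ 2 = z ^ 2 := by
        linear_combination hv - z' ^ 2 * d' + z ^ 2 * d
      refine ⟨?_, .inr (.inr (.inr (.inr ⟨e, e', f', f⟩)))⟩
      rcases h2 with ⟨-, h2, -⟩ | ⟨-, h2, -⟩ <;>
      rcases sq_eq_sq_iff_eq_or_eq_neg.1 f' with rfl | rfl
      · refine re_mul_im_eq_zero_of_pow (m := c * c' + s * s') ?_
        rw [hz, one_mul] at h2
        push_cast
        exact h2
      · refine re_mul_im_eq_zero_of_pow (m := c * c' - s * s') ?_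
        rw [map_neg, mul_neg, hz, neg_one_mul] at h2
        push_cast
        exact h2
      · refine re_mul_im_eq_zero_of_pow (m := s * c' - c * s') ?_
        push_cast
        linear_combination h2 - (r * (s * c' - c * s')) ^ 4 * f
      · refine re_mul_im_eq_zero_of_pow (m := s * c' + c * s') ?_
        push_cast
        linear_combination h2 - (r * (s * c' + c * s')) ^ 4 * f
  · rintro ⟨hr', hcl⟩
    have hr4 := pow_four_eq_one_of_re_mul_im hr hr'
    rcases hcl with ⟨rfl, rfl⟩ | ⟨rfl, rfl, f⟩ | ⟨rfl, rfl, f⟩ | ⟨rfl, rfl, f1, f2⟩ | ⟨e, e', f', f⟩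
    · simp only [Complex.ofReal_zero, mul_zero, zero_mul, add_zero, sub_zero, zero_sub,
          ne_eq, OfNat.ofNat_ne_zero, not_false_eq_true, zero_pow, zero_ne_one, false_and, and_false,
          or_false, false_or, true_and, and_self, neg_zero] at hC hC' ⊢
      have hcc : ((c : ℂ) * c') ^ 4 = 1 := by
        rw [mul_pow]
        linear_combination c' ^ 4 * (c ^ 2 + 1) * hC + (c' ^ 2 + 1) * hC'
      have hcr : (r * ((c : ℂ) * c')) ^ 4 = 1 := by rw [mul_pow, hr4, hcc, one_mul]
      exact ⟨by norm_num [hC, hC'], hcr, trivial⟩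
    · simp only [Complex.ofReal_zero, mul_zero, zero_mul, add_zero, zero_add, sub_zero, zero_sub,
          ne_eq, OfNat.ofNat_ne_zero, not_false_eq_true, zero_pow, zero_ne_one, false_and, and_false,
          or_false, false_or, true_and, and_self, neg_zero] at hC hC' ⊢
      have hcc : ((c : ℂ) * s') ^ 2 = 1 := by linear_combination s' ^ 2 * hC + hC'
      have hz2 := conj_sq_of_pow_four f
      generalize (c : ℂ) * s' = m at hcc
      refine ⟨by norm_num [hC, hC'], ⟨?_, ?_⟩, ?_, ?_⟩
      · linear_combination r ^ 4 * z' ^ 4 * (m ^ 2 + 1) * hcc + r ^ 4 * f + hr4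
      · linear_combination r ^ 2 * m ^ 2 * hz2
      · linear_combination r ^ 4 * conj z' ^ 4 * (m ^ 2 + 1) * hcc + r ^ 4 * f + hr4 +
          r ^ 4 * (conj z' ^ 2 + z' ^ 2) * hz2
      · linear_combination -r ^ 2 * m ^ 2 * hz2
    · simp only [Complex.ofReal_zero, mul_zero, zero_mul, add_zero, zero_add, sub_zero, zero_sub,
          ne_eq, OfNat.ofNat_ne_zero, not_false_eq_true, zero_pow, zero_ne_one, false_and, and_false,
          or_false, false_or, true_and, and_self, neg_zero] at hC hC' ⊢
      have hcc : ((s : ℂ) * c') ^ 2 = 1 := by linear_combination c' ^ 2 * hC + hC'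
      have hz2 := conj_sq_of_pow_four f
      generalize (s : ℂ) * c' = m at hcc
      refine ⟨by norm_num [hC, hC'], ⟨?_, ?_⟩, ?_, ?_⟩
      · linear_combination r ^ 4 * z ^ 4 * (m ^ 2 + 1) * hcc + r ^ 4 * f + hr4
      · linear_combination r ^ 2 * m ^ 2 * hz2
      · linear_combination r ^ 4 * z ^ 4 * (m ^ 2 + 1) * hcc + r ^ 4 * f + hr4
      · linear_combination r ^ 2 * m ^ 2 * hz2
    · simp only [Complex.ofReal_zero, mul_zero, zero_mul, add_zero, zero_add, sub_zero, zero_sub,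
          ne_eq, OfNat.ofNat_ne_zero, not_false_eq_true, zero_pow, zero_ne_one, false_and, and_false,
          or_false, false_or, true_and, and_self, neg_zero] at hC hC' ⊢
      have hcc : ((s : ℂ) * s') ^ 2 = 1 := by linear_combination s' ^ 2 * hC + hC'
      have hz1 := conj_sq_of_pow_four f1
      have hz2 := conj_sq_of_pow_four f2
      simp only [map_mul, Complex.conj_conj] at hz1 hz2
      generalize (s : ℂ) * s' = m at hcc
      refine ⟨by norm_num [hC, hC'], ⟨?_, ?_⟩, ?_, ?_⟩
      · linear_combination r ^ 4 * (z * conj z') ^ 4 * (m ^ 2 + 1) * hcc + r ^ 4 * f1 + hr4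
      · linear_combination r ^ 2 * m ^ 2 * hz1
      · linear_combination r ^ 4 * (z * z') ^ 4 * (m ^ 2 + 1) * hcc + r ^ 4 * f2 + hr4
      · linear_combination r ^ 2 * m ^ 2 * hz2
    -- Balanced case: writing c = αs, c' = βs', z' = ηz with signs α, β, η reduces every block entry
    -- to a monomial in z times a combination of signs.
    · have sgn {x y : ℝ} (h : x ^ 2 = y ^ 2) : ∃ α : ℂ, α ^ 2 = 1 ∧ (x : ℂ) = α * y := by
        rcases sq_eq_sq_iff_eq_or_eq_neg.1 h with rfl | rfl
        · exact ⟨1, by simp⟩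
        · exact ⟨-1, by simp⟩
      obtain ⟨α, hα, e⟩ := sgn e
      obtain ⟨β, hβ, e'⟩ := sgn e'
      have hzc := conj_eq_pow_three f
      have hzc' : conj z' = z ^ 2 * z' := by
        rw [conj_eq_pow_three (by linear_combination (z' ^ 2 + z ^ 2) * f' + f)]
        linear_combination z' * f'
      have hη : ∃ η : ℂ, η ^ 2 = 1 ∧ z' = η * z := by
        rcases sq_eq_sq_iff_eq_or_eq_neg.1 f' with rfl | rfl
        · exact ⟨1, by simp⟩
        · exact ⟨-1, by simp⟩
      obtain ⟨η, hη, e1⟩ := hη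
      rw [hzc, hzc', e1, e, e']
      rw [e, mul_pow, hα] at hC
      rw [e', mul_pow, hβ] at hC'
      clear e e' hzc hzc' e1 f'
      have hm : (2 * ((s : ℂ) * s')) ^ 2 = 1 := by
        linear_combination 2 * s' ^ 2 * hC + hC'
      have hγ : (α * β * η - 1) * (α * β * η + 1) = 0 := by
        linear_combination β ^ 2 * η ^ 2 * hα + η ^ 2 * hβ + hη
      have hκ : (α * β * η * z ^ 2 - 1) * (α * β * η * z ^ 2 + 1) = 0 := by
        linear_combination z ^ 4 * (β ^ 2 * η ^ 2 * hα + η ^ 2 * hβ + hη) + f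
      generalize (s : ℂ) = s, (s' : ℂ) = s' at *
      refine ⟨.inr ⟨⟨?_, ?_, ?_, ?_⟩, ?_, ?_, ?_, ?_⟩, ?_, ?_⟩
      · grind
      · grind
      · grind
      · grind
      · grind
      · grind
      · grind
      · grind
      -- AC† is diagonal if αβη = 1 and antidiagonal if αβη = -1. For AXC† the same role is played
      -- by the sign αβηz².
      · rcases mul_eq_zero.1 hγ with hγ | hγ
        · refine .inl ⟨⟨?_, ?_⟩, ?_, ?_⟩
          · grind
          · grind
          · grind
          · grind
        · refine .inr ⟨⟨?_, ?_⟩, ?_, ?_⟩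
          · grind
          · grind
          · grind
          · grind
      · rcases mul_eq_zero.1 hκ with hκ | hκ
        · refine .inl ⟨⟨?_, ?_⟩, ?_, ?_⟩
          · grind
          · grind
          · grind
          · grind
        · refine .inr ⟨⟨?_, ?_⟩, ?_, ?_⟩
          · grind
          · grind
          · grind
          · grind

/-! ### Unitarity, determinant and reshuffling for blocks of rotation form. -/

theorem smul_rot (k ε : ℂ) (c s : ℝ) (z : ℂ) : k • rot ε c s z = rot (k * ε) c s z := by
  ext i j
  fin_cases i <;> fin_cases j <;> simp [rot, mul_assoc]

theorem rot_eq_zero {ε : ℂ} {c s : ℝ} {z : ℂ} (hz : z * conj z = 1)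
    (h : Complex.normSq ε * (c ^ 2 + s ^ 2) = 0) : rot ε c s z = 0 := by
  open scoped ComplexOrder in
  rw [← Matrix.self_mul_conjTranspose_eq_zero, rot_mul_conjTranspose _ _ _ hz, h]
  simp

theorem det_rot {ε : ℂ} {c s : ℝ} {z : ℂ} (hz : z * conj z = 1) :
    (rot ε c s z).det = ε ^ 2 * (c ^ 2 + s ^ 2) := by
  simp only [rot, Matrix.det_fin_two_of]
  linear_combination ε ^ 2 * s ^ 2 * hz

theorem mem_unitaryGroup_rot_iff {ε ε' z z' : ℂ} {c s c' s' : ℝ} (hz : z * conj z = 1)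
    (hz' : z' * conj z' = 1) :
    xType (rot ε c s z) (rot ε' c' s' z') ∈ Matrix.unitaryGroup (Fin 2 × Fin 2) ℂ ↔
      Complex.normSq ε * (c ^ 2 + s ^ 2) = 1 ∧ Complex.normSq ε' * (c' ^ 2 + s' ^ 2) = 1 := by
  have key (r : ℝ) : (r : ℂ) • (1 : Matrix (Fin 2) (Fin 2) ℂ) = 1 ↔ r = 1 := by
    refine ⟨fun h => ?_, fun h => by simp [h]⟩
    have := congrFun (congrFun h 0) 0
    simpa using this
  rw [mem_unitaryGroup_iff_xType, rot_mul_conjTranspose _ _ _ hz, rot_mul_conjTranspose _ _ _ hz',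
    key, key]

theorem isMatchgate_rot_iff {ε ε' z z' : ℂ} {c s c' s' : ℝ} (hz : z * conj z = 1)
    (hz' : z' * conj z' = 1) (h : Complex.normSq ε * (c ^ 2 + s ^ 2) = 1)
    (h' : Complex.normSq ε' * (c' ^ 2 + s' ^ 2) = 1) :
    IsMatchgate (xType (rot ε c s z) (rot ε' c' s' z')) ↔
      ε ^ 2 * (c ^ 2 + s ^ 2) = ε' ^ 2 * (c' ^ 2 + s' ^ 2) := by
  rw [← det_rot hz, ← det_rot hz']
  constructor
  · rintro ⟨-, A, C, hd, e⟩
    obtain ⟨rfl, rfl⟩ := xType_inj.1 e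
    exact hd
  · exact fun hd => ⟨(mem_unitaryGroup_rot_iff hz hz').2 ⟨h, h'⟩, _, _, hd, rfl⟩

/-- The rows of the first reshuffled block have squared norm |ε|²c² + |ε'|²c'² and overlap 2cc' Re(ε
ε̄'). Given unitarity, the norm condition is |ε|²c² = |ε'|²s'², which also settles the norms of the
second block. -/
theorem isDualUnitary_rot_iff {ε ε' z z' : ℂ} {c s c' s' : ℝ} (hz : z * conj z = 1)
    (hz' : z' * conj z' = 1) (h : Complex.normSq ε * (c ^ 2 + s ^ 2) = 1)
    (h' : Complex.normSq ε' * (c' ^ 2 + s' ^ 2) = 1) :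
    IsDualUnitary (xType (rot ε c s z) (rot ε' c' s' z')) ↔
      Complex.normSq ε * c ^ 2 = Complex.normSq ε' * s' ^ 2 ∧
        (c * c' = 0 ∨ (ε * conj ε').re = 0) := by
  have hne' : ε' ≠ 0 := by rintro rfl; simp at h'
  have hne : ε ≠ 0 := by rintro rfl; simp at h
  have re2 : ε * conj ε' + ε' * conj ε = ((2 * (ε * conj ε').re : ℝ) : ℂ) := by
    rw [← Complex.add_conj]
    simp [mul_comm]
  have c1 : ε * conj ε * (c ^ 2 + s ^ 2) = 1 := by
    rw [Complex.mul_conj]; exact_mod_cast h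
  have c1' : ε' * conj ε' * (c' ^ 2 + s' ^ 2) = 1 := by
    rw [Complex.mul_conj]; exact_mod_cast h'
  have hiff : Complex.normSq ε * c ^ 2 = Complex.normSq ε' * s' ^ 2 ↔
      ε * conj ε * c ^ 2 = ε' * conj ε' * s' ^ 2 := by
    rw [Complex.mul_conj, Complex.mul_conj]; norm_cast
  rw [IsDualUnitary, mem_unitaryGroup_rot_iff hz hz', dualOp_xType, mem_unitaryGroup_iff_xType,
    hiff]
  simp only [h, h', and_self, true_and]
  constructor
  · rintro ⟨h1, -⟩
    have e00 := congrFun (congrFun h1 0) 0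
    have e01 := congrFun (congrFun h1 0) 1
    simp [rot, Matrix.mul_apply, Fin.sum_univ_two] at e00 e01
    refine ⟨by linear_combination e00 - c1', ?_⟩
    have : ((c * c' * (2 * (ε * conj ε').re) : ℝ) : ℂ) = 0 := by
      rw [Complex.ofReal_mul, ← re2]
      push_cast
      linear_combination e01
    have : c * c' * (2 * (ε * conj ε').re) = 0 := by exact_mod_cast this
    simpa [or_assoc] using this
  · rintro ⟨h1, h2⟩
    have k1 : (c * c' : ℂ) * (ε * conj ε' + ε' * conj ε) = 0 := by
      rw [re2]
      rcases h2 with h2 | h2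
      · rw [← Complex.ofReal_mul, h2]; simp
      · rw [h2]; simp
    -- Orthogonality in the second reshuffled block needs ss' Re(ε ε̄') = 0. If cc' = 0, the norm
    -- condition makes ss' vanish too: c = 0 gives s' = 0, and c' = 0 gives s = 0.
    have k2 : (s * s' : ℂ) * (ε * conj ε' + ε' * conj ε) = 0 := by
      rcases h2 with h2 | h2
      · have n' : ε' * conj ε' ≠ 0 := by simp [hne']
        have n : ε * conj ε ≠ 0 := by simp [hne]
        rcases mul_eq_zero.1 h2 with rfl | rfl
        · have : ε' * conj ε' * s' ^ 2 = 0 := by rw [← h1]; simp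
          simp [pow_eq_zero_iff two_ne_zero |>.1 ((mul_eq_zero.1 this).resolve_left n')]
        · have : ε * conj ε * s ^ 2 = 0 := by
            simp only [Complex.ofReal_zero] at c1'
            linear_combination c1 - c1' - h1
          simp [pow_eq_zero_iff two_ne_zero |>.1 ((mul_eq_zero.1 this).resolve_left n)]
      · rw [re2, h2]; simp
    constructor
    · ext i j
      fin_cases i <;> fin_cases j <;> simp [rot, Matrix.mul_apply, Fin.sum_univ_two]
      · linear_combination h1 + c1'
      · linear_combination k1
      · linear_combination k1
      · linear_combination h1 + c1'
    · ext i j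
      fin_cases i <;> fin_cases j <;> simp [rot, Matrix.mul_apply, Fin.sum_univ_two]
      · linear_combination -h1 + c1 + ε * conj ε * s ^ 2 * hz + ε' * conj ε' * s' ^ 2 * hz'
      · linear_combination conj z * z' * k2
      · linear_combination z * conj z' * k2
      · linear_combination -h1 + c1 + ε * conj ε * s ^ 2 * hz + ε' * conj ε' * s' ^ 2 * hz'

/-! ### Properties up to a scalar -/

theorem upToScalar_smul {P : TwoQubit → Prop} {k : ℂ} (hk : k ≠ 0) (M : TwoQubit) :
    UpToScalar P (k • M) ↔ UpToScalar P M := by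
  constructor
  · rintro ⟨c, hc, h⟩
    exact ⟨c * k, mul_ne_zero hc hk, by rwa [← smul_smul]⟩
  · rintro ⟨c, hc, h⟩
    exact ⟨c / k, div_ne_zero hc hk, by rwa [smul_smul, div_mul_cancel₀ _ hk]⟩

theorem cliffordRot_smul_left {r : ℝ} (hr : r ≠ 0) (c s : ℝ) (z : ℂ) (c' s' : ℝ) (z' : ℂ) :
    CliffordRot (r * c) (r * s) z c' s' z' ↔ CliffordRot c s z c' s' z' := by
  simp only [CliffordRot, mul_eq_zero, hr, false_or, mul_pow,
    mul_right_inj' (pow_ne_zero 2 hr)]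

/-- Interchanging the parity sectors preserves the condition; this carries results from label I to
label II. -/
theorem CliffordRot.symm {c s c' s' : ℝ} {z z' : ℂ} (h : CliffordRot c s z c' s' z') :
    CliffordRot c' s' z' c s z := by
  rcases h with ⟨h1, h2⟩ | ⟨h1, h2, h3⟩ | ⟨h1, h2, h3⟩ | ⟨h1, h2, h3, h4⟩ | ⟨h1, h2, h3, h4⟩
  · exact .inl ⟨h2, h1⟩
  · exact .inr (.inr (.inl ⟨h2, h1, h3⟩))
  · exact .inr (.inl ⟨h2, h1, h3⟩)
  · refine .inr (.inr (.inr (.inl ⟨h2, h1, ?_, by rwa [mul_comm]⟩)))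
    have := congrArg conj h3
    simpa [mul_comm] using this
  · exact .inr (.inr (.inr (.inr ⟨h2, h1, h3.symm, by
      linear_combination h4 + (z' ^ 2 + z ^ 2) * h3⟩)))

theorem cliffordRot_comm {c s c' s' : ℝ} {z z' : ℂ} :
    CliffordRot c s z c' s' z' ↔ CliffordRot c' s' z' c s z := ⟨.symm, .symm⟩

/-- The blocks `rot ε c s z` and `rot ε' c' s' z'` are nonzero multiples of unitary matrices, with
the same modulus of the factor. -/
structure IsRotPair (ε : ℂ) (c s : ℝ) (z ε' : ℂ) (c' s' : ℝ) (z' : ℂ) : Prop where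
  norm_left : z * conj z = 1
  norm_right : z' * conj z' = 1
  ne_zero : Complex.normSq ε * (c ^ 2 + s ^ 2) ≠ 0
  eq : Complex.normSq ε * (c ^ 2 + s ^ 2) = Complex.normSq ε' * (c' ^ 2 + s' ^ 2)

namespace IsRotPair

variable {ε ε' z z' : ℂ} {c s c' s' : ℝ}

theorem symm (H : IsRotPair ε c s z ε' c' s' z') : IsRotPair ε' c' s' z' ε c s z :=
  ⟨H.norm_right, H.norm_left, H.eq ▸ H.ne_zero, H.eq.symm⟩

theorem left_ne_zero (H : IsRotPair ε c s z ε' c' s' z') : ε ≠ 0 := by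
  rintro rfl
  exact H.ne_zero (by simp)

theorem sq_add_sq_pos (H : IsRotPair ε c s z ε' c' s' z') : 0 < c ^ 2 + s ^ 2 := by
  have := right_ne_zero_of_mul H.ne_zero
  positivity

theorem smul_mem_iff (H : IsRotPair ε c s z ε' c' s' z') {k : ℂ} :
    k • xType (rot ε c s z) (rot ε' c' s' z') ∈ Matrix.unitaryGroup (Fin 2 × Fin 2) ℂ ↔
      Complex.normSq k * (Complex.normSq ε * (c ^ 2 + s ^ 2)) = 1 := by
  rw [smul_xType, smul_rot, smul_rot, mem_unitaryGroup_rot_iff H.norm_left H.norm_right, map_mul,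
    map_mul, mul_assoc, mul_assoc, ← H.eq, and_self]

theorem exists_smul_mem (H : IsRotPair ε c s z ε' c' s' z') : ∃ k : ℂ, k ≠ 0 ∧
    Complex.normSq k * (Complex.normSq ε * (c ^ 2 + s ^ 2)) = 1 := by
  have hpos : 0 < Complex.normSq ε * (c ^ 2 + s ^ 2) :=
    mul_pos (Complex.normSq_pos.2 H.left_ne_zero) H.sq_add_sq_pos
  refine ⟨((√(Complex.normSq ε * (c ^ 2 + s ^ 2)))⁻¹ : ℝ), ?_, ?_⟩
  · simpa using (Real.sqrt_pos.2 hpos).ne'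
  · rw [Complex.normSq_ofReal, ← mul_inv, Real.mul_self_sqrt hpos.le, inv_mul_cancel₀ hpos.ne']

theorem upToScalar_unitary (H : IsRotPair ε c s z ε' c' s' z') :
    UpToScalar (· ∈ Matrix.unitaryGroup (Fin 2 × Fin 2) ℂ)
      (xType (rot ε c s z) (rot ε' c' s' z')) := by
  obtain ⟨k, hk, h⟩ := H.exists_smul_mem
  exact ⟨k, hk, H.smul_mem_iff.2 h⟩

/-- Unitarity fixes the modulus of the admissible scalar and such a scalar exists. A property that
implies unitarity and has the same criterion at every normalizing scalar can therefore be decided at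
any one of them. -/
theorem upToScalar_iff_of_smul (H : IsRotPair ε c s z ε' c' s' z') {P : TwoQubit → Prop} {p : Prop}
    (hP : ∀ U, P U → U ∈ Matrix.unitaryGroup (Fin 2 × Fin 2) ℂ)
    (h : ∀ k : ℂ, k ≠ 0 → Complex.normSq (k * ε) * (c ^ 2 + s ^ 2) = 1 →
      Complex.normSq (k * ε') * (c' ^ 2 + s' ^ 2) = 1 →
      (P (xType (rot (k * ε) c s z) (rot (k * ε') c' s' z')) ↔ p)) :
    UpToScalar P (xType (rot ε c s z) (rot ε' c' s' z')) ↔ p := by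
  have h' (k : ℂ) (hk : k ≠ 0) (e : Complex.normSq k * (Complex.normSq ε * (c ^ 2 + s ^ 2)) = 1) :
      P (k • xType (rot ε c s z) (rot ε' c' s' z')) ↔ p := by
    rw [smul_xType, smul_rot, smul_rot]
    refine h k hk ?_ ?_
    · rw [map_mul, mul_assoc, e]
    · rw [map_mul, mul_assoc, ← H.eq, e]
  constructor
  · rintro ⟨k, hk, hPk⟩
    exact (h' k hk (H.smul_mem_iff.1 (hP _ hPk))).1 hPk
  · intro hp
    obtain ⟨k, hk, e⟩ := H.exists_smul_mem
    exact ⟨k, hk, (h' k hk e).2 hp⟩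

theorem upToScalar_isMatchgate_iff (H : IsRotPair ε c s z ε' c' s' z') :
    UpToScalar IsMatchgate (xType (rot ε c s z) (rot ε' c' s' z')) ↔
      ε ^ 2 * (c ^ 2 + s ^ 2) = ε' ^ 2 * (c' ^ 2 + s' ^ 2) := by
  refine H.upToScalar_iff_of_smul (fun U h => h.1) fun k hk e e' => ?_
  rw [isMatchgate_rot_iff H.norm_left H.norm_right e e', mul_pow, mul_pow, mul_assoc, mul_assoc,
    mul_right_inj' (pow_ne_zero _ hk)]

theorem upToScalar_isDualUnitary_iff (H : IsRotPair ε c s z ε' c' s' z') :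
    UpToScalar IsDualUnitary (xType (rot ε c s z) (rot ε' c' s' z')) ↔
      Complex.normSq ε * c ^ 2 = Complex.normSq ε' * s' ^ 2 ∧
        (c * c' = 0 ∨ (ε * conj ε').re = 0) := by
  refine H.upToScalar_iff_of_smul (fun U h => h.1) fun k hk e e' => ?_
  have hk' : Complex.normSq k ≠ 0 := by simpa
  have h2 : k * ε * conj (k * ε') = ((Complex.normSq k : ℝ) : ℂ) * (ε * conj ε') := by
    rw [← Complex.mul_conj, map_mul]; ring
  rw [isDualUnitary_rot_iff H.norm_left H.norm_right e e', h2, Complex.re_ofReal_mul, map_mul,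
    map_mul, mul_assoc, mul_assoc, mul_right_inj' hk', mul_eq_zero (a := Complex.normSq k)]
  simp [hk]

theorem upToScalar_isClifford_iff (H : IsRotPair ε c s z ε' c' s' z') :
    UpToScalar IsClifford (xType (rot ε c s z) (rot ε' c' s' z')) ↔
      (ε * conj ε').re * (ε * conj ε').im = 0 ∧ CliffordRot c s z c' s' z' := by
  refine H.upToScalar_iff_of_smul (fun U h => h.1) fun k hk e e' => ?_
  -- The Clifford criterion assumes c² + s² = 1, so the radius is moved from (a, b) into the complex
  -- factor. Positive real factors affect neither `CliffordRot` nor the vanishing of Re · Im.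
  have key {η : ℂ} {a b : ℝ} (w : ℂ) (hn : 0 < a ^ 2 + b ^ 2)
      (h : Complex.normSq η * (a ^ 2 + b ^ 2) = 1) :
      ∃ r : ℝ, 0 < r ∧ rot η a b w = rot (r * η) (r⁻¹ * a) (r⁻¹ * b) w ∧
        (r * η) * conj (r * η) = 1 ∧ (r⁻¹ * a) ^ 2 + (r⁻¹ * b) ^ 2 = 1 := by
    have hr : 0 < √(a ^ 2 + b ^ 2) := Real.sqrt_pos.2 hn
    have hr2 : √(a ^ 2 + b ^ 2) ^ 2 = a ^ 2 + b ^ 2 := Real.sq_sqrt hn.le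
    generalize √(a ^ 2 + b ^ 2) = r at hr hr2
    have hrc : (r : ℂ) ≠ 0 := by exact_mod_cast hr.ne'
    refine ⟨r, hr, ?_, ?_, ?_⟩
    · ext i j
      fin_cases i <;> fin_cases j <;> simp [rot] <;> field_simp
    · rw [Complex.mul_conj, map_mul, Complex.normSq_ofReal]
      norm_cast
      rw [← h, ← hr2]; ring
    · rw [mul_pow, mul_pow, ← mul_add, ← hr2, ← mul_pow, inv_mul_cancel₀ hr.ne', one_pow]
  obtain ⟨r, hr, e1, e2, e3⟩ := key z H.sq_add_sq_pos e
  obtain ⟨r', hr', e1', e2', e3'⟩ := key z' H.symm.sq_add_sq_pos e'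
  have h2 : r * (k * ε) * conj (r' * (k * ε')) =
      ((r * r' * Complex.normSq k : ℝ) : ℂ) * (ε * conj ε') := by
    push_cast
    rw [← Complex.mul_conj, map_mul, map_mul, Complex.conj_ofReal]; ring
  rw [e1, e1', isClifford_rot_iff e2 e2' H.norm_left H.norm_right e3 e3',
    cliffordRot_smul_left (inv_ne_zero hr.ne'), cliffordRot_comm,
    cliffordRot_smul_left (inv_ne_zero hr'.ne'), cliffordRot_comm, h2, Complex.re_ofReal_mul,
    Complex.im_ofReal_mul]
  simp [hr.ne', hr'.ne', hk]

end IsRotPair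

/-- Since both blocks have the same norm, a vanishing norm would make the whole matrix zero; this is
where the nonvanishing assumption on a gate enters. -/
theorem isRotPair_of_smul_ne_zero {M : TwoQubit} {k ε ε' z z' : ℂ} {c s c' s' : ℝ}
    (hM : M ≠ 0) (e : M = k • xType (rot ε c s z) (rot ε' c' s' z')) (hz : z * conj z = 1)
    (hz' : z' * conj z' = 1)
    (h : Complex.normSq ε * (c ^ 2 + s ^ 2) = Complex.normSq ε' * (c' ^ 2 + s' ^ 2)) :
    IsRotPair ε c s z ε' c' s' z' := by
  refine ⟨hz, hz', fun h0 => hM ?_, h⟩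
  rw [e, rot_eq_zero hz h0, rot_eq_zero hz' (h ▸ h0), xType_zero, smul_zero]

theorem upToScalar_isNontrivialMatchgate_iff {M : TwoQubit} :
    UpToScalar IsNontrivialMatchgate M ↔
      UpToScalar IsMatchgate M ∧ ¬ ∃ c : ℂ, M = c • (1 : TwoQubit) := by
  constructor
  · rintro ⟨k, hk, h, h'⟩
    exact ⟨⟨k, hk, h⟩, fun ⟨c, e⟩ => h' ⟨k * c, by rw [e, smul_smul]⟩⟩
  · rintro ⟨⟨k, hk, h⟩, h'⟩
    refine ⟨k, hk, h, fun ⟨c, e⟩ => h' ⟨k⁻¹ * c, ?_⟩⟩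
    rw [← smul_smul, ← e, smul_smul, inv_mul_cancel₀ hk, one_smul]

/-! ### Phases and angles -/

theorem phase_ne_zero (θ : ℝ) : phase θ ≠ 0 := Complex.exp_ne_zero _

theorem phase_add (a b : ℝ) : phase (a + b) = phase a * phase b := by
  simp [phase, mul_add, Complex.exp_add]

theorem phase_neg (a : ℝ) : phase (-a) = (phase a)⁻¹ := by
  simp [phase, Complex.exp_neg]

theorem conj_phase (θ : ℝ) : conj (phase θ) = (phase θ)⁻¹ := by
  rw [← phase_neg]
  simp [phase, ← Complex.exp_conj]

theorem phase_mul_conj (θ : ℝ) : phase θ * conj (phase θ) = 1 := by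
  rw [conj_phase, mul_inv_cancel₀ (phase_ne_zero θ)]

theorem phase_eq (θ : ℝ) : phase θ = cos θ + sin θ * Complex.I := by
  rw [phase, mul_comm, Complex.exp_mul_I]
  simp

theorem phase_re (θ : ℝ) : (phase θ).re = cos θ := by simp [phase_eq, -Complex.ofReal_cos]

theorem phase_im (θ : ℝ) : (phase θ).im = sin θ := by simp [phase_eq, -Complex.ofReal_sin]

theorem ofReal_cos_eq (θ : ℝ) : ((cos θ : ℝ) : ℂ) = (phase θ + (phase θ)⁻¹) / 2 := by
  rw [← phase_neg, phase_eq, phase_eq, cos_neg, sin_neg]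
  push_cast; ring

theorem ofReal_sin_eq (θ : ℝ) :
    ((sin θ : ℝ) : ℂ) = -Complex.I * (phase θ - (phase θ)⁻¹) / 2 := by
  rw [← phase_neg, phase_eq, phase_eq, cos_neg, sin_neg]
  push_cast
  linear_combination Complex.sin θ * Complex.I_sq

theorem isIntMul_pi_iff {t : ℝ} : IsIntMul t π ↔ sin t = 0 := by
  rw [Real.sin_eq_zero_iff]
  exact exists_congr fun k => eq_comm

theorem isIntMul_sub_pi_div_two_iff {t : ℝ} : IsIntMul (t - π / 2) π ↔ cos t = 0 := by
  rw [isIntMul_pi_iff, Real.sin_sub_pi_div_two, neg_eq_zero]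

theorem isIntMul_pi_div_two_iff {t : ℝ} : IsIntMul t (π / 2) ↔ sin t * cos t = 0 := by
  have : IsIntMul t (π / 2) ↔ IsIntMul (2 * t) π :=
    exists_congr fun k => ⟨fun h => by linear_combination 2 * h,
      fun h => by linear_combination h / 2⟩
  rw [this, isIntMul_pi_iff, sin_two_mul, mul_assoc]
  simp

theorem isIntMul_sub_pi_div_four_iff {t : ℝ} :
    IsIntMul (t - π / 4) (π / 2) ↔ cos t ^ 2 = sin t ^ 2 := by
  have : IsIntMul (t - π / 4) (π / 2) ↔ IsIntMul (2 * t - π / 2) π :=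
    exists_congr fun k => ⟨fun h => by linear_combination 2 * h,
      fun h => by linear_combination h / 2⟩
  rw [this, isIntMul_sub_pi_div_two_iff, cos_two_mul', sub_eq_zero]

theorem phase_pow_four_iff {t : ℝ} : phase t ^ 4 = 1 ↔ IsIntMul t (π / 2) := by
  rw [isIntMul_pi_div_two_iff]
  constructor
  · intro h
    have := re_mul_im_eq_zero_of_pow (r := phase t) (m := 1) (by simpa using h)
    rwa [phase_re, phase_im, mul_comm] at this
  · intro h
    exact pow_four_eq_one_of_re_mul_im (phase_mul_conj t) (by rwa [phase_re, phase_im, mul_comm])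

theorem phase_sq_eq_neg_one_iff {t : ℝ} : phase t ^ 2 = -1 ↔ IsIntMul (t - π / 2) π := by
  rw [isIntMul_sub_pi_div_two_iff, Complex.ext_iff]
  simp only [pow_two, Complex.mul_re, Complex.mul_im, phase_re, phase_im]
  have := sin_sq_add_cos_sq t
  constructor
  · rintro ⟨h, -⟩
    simp at h
    exact pow_eq_zero_iff two_ne_zero |>.1 (by linear_combination this / 2 + h / 2)
  · intro h
    rw [h] at this ⊢
    simp
    linear_combination this

theorem phase_sq_eq_one_iff {t : ℝ} : phase t ^ 2 = 1 ↔ IsIntMul t π := by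
  rw [isIntMul_pi_iff, Complex.ext_iff]
  simp only [pow_two, Complex.mul_re, Complex.mul_im, phase_re, phase_im]
  have := sin_sq_add_cos_sq t
  constructor
  · rintro ⟨h, -⟩
    simp at h
    exact pow_eq_zero_iff two_ne_zero |>.1 (by linear_combination this / 2 - h / 2)
  · intro h
    rw [h] at this ⊢
    simp
    linear_combination this

/-- Cleared of denominators and signs, the equation is u² = v² for u = sinh h cos θ and v = cosh h
sin θ. The condition cos θ ≠ 0 is automatic there, because cosh h > 0. -/
theorem tanh_eq_tan_iff {h θ : ℝ} :
    (cos θ ≠ 0 ∧ (tanh h = tan θ ∨ tanh h = -tan θ)) ↔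
      sinh h ^ 2 * cos θ ^ 2 = cosh h ^ 2 * sin θ ^ 2 := by
  have hc := (cosh_pos h).ne'
  constructor
  · rintro ⟨h0, h1⟩
    rw [← sq_eq_sq_iff_eq_or_eq_neg, tanh_eq_sinh_div_cosh, tan_eq_sin_div_cos] at h1
    field_simp at h1
    linear_combination h1
  · intro h1
    have h0 : cos θ ≠ 0 := by
      intro h0
      have := sin_sq_add_cos_sq θ
      rw [h0] at this h1
      have : cosh h ^ 2 = 0 := by linear_combination -cosh h ^ 2 * this - h1
      exact hc (pow_eq_zero_iff two_ne_zero |>.1 this)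
    refine ⟨h0, ?_⟩
    rw [← sq_eq_sq_iff_eq_or_eq_neg, tanh_eq_sinh_div_cosh, tan_eq_sin_div_cos]
    field_simp
    linear_combination h1

theorem tanh_eq_cot_iff {h θ : ℝ} :
    (sin θ ≠ 0 ∧ (tanh h = cot θ ∨ tanh h = -cot θ)) ↔
      sinh h ^ 2 * sin θ ^ 2 = cosh h ^ 2 * cos θ ^ 2 := by
  have := tanh_eq_tan_iff (h := h) (θ := π / 2 - θ)
  rwa [cos_pi_div_two_sub, sin_pi_div_two_sub, tan_pi_div_two_sub, ← cot_inv_eq_tan, inv_inv] at this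

/-! ### The gates in terms of rotations -/

/-- The X-type operator with block `A` on the parity sector fixed by the braid gate with label `l`
up to the phase `e^{iφ₁}`, and block `C` on the other one. -/
def sector (l : BraidLabel) (A C : Matrix (Fin 2) (Fin 2) ℂ) : TwoQubit :=
  match l with
  | .I => xType A C
  | .II => xType C A

theorem sector_add (l : BraidLabel) (A C A' C' : Matrix (Fin 2) (Fin 2) ℂ) :
    sector l A C + sector l A' C' = sector l (A + A') (C + C') := by
  cases l <;> exact xType_add _ _ _ _

theorem smul_sector (l : BraidLabel) (k : ℂ) (A C : Matrix (Fin 2) (Fin 2) ℂ) :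
    k • sector l A C = sector l (k • A) (k • C) := by
  cases l <;> exact smul_xType _ _ _

theorem sector_conjTranspose (l : BraidLabel) (A C : Matrix (Fin 2) (Fin 2) ℂ) :
    (sector l A C)ᴴ = sector l Aᴴ Cᴴ := by
  cases l <;> exact xType_conjTranspose _ _

theorem sector_one (l : BraidLabel) : sector l 1 1 = 1 := by
  cases l <;> exact xType_one

theorem sector_inj {l : BraidLabel} {A C A' C' : Matrix (Fin 2) (Fin 2) ℂ} :
    sector l A C = sector l A' C' ↔ A = A' ∧ C = C' := by
  cases l
  · exact xType_inj
  · exact xType_inj.trans and_comm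

theorem braidGate_eq (l : BraidLabel) (φ₁ φ₂ φ₃ : ℝ) :
    braidGate l φ₁ φ₂ φ₃ = sector l (phase φ₁ • 1) !![0, phase φ₂; phase φ₃, 0] := by
  cases l <;> simp [sector, xType, braidGate, braidI, braidII]

theorem braidIII_eq (φ₁ φ₂ : ℝ) :
    braidIII φ₁ φ₂ = xType !![(cos φ₁ : ℂ), sin φ₁ * phase φ₂; -(sin φ₁ * phase (-φ₂)), cos φ₁]
      !![-Complex.I * sin φ₁, -(cos φ₁ : ℂ); -(cos φ₁ : ℂ), -Complex.I * sin φ₁] := by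
  simp [xType, braidIII]

namespace IsRotPair

variable {l : BraidLabel} {ε ε' z z' : ℂ} {c s c' s' : ℝ}

theorem sector_upToScalar_unitary (H : IsRotPair ε c s z ε' c' s' z') :
    UpToScalar (· ∈ Matrix.unitaryGroup (Fin 2 × Fin 2) ℂ)
      (sector l (rot ε c s z) (rot ε' c' s' z')) := by
  cases l
  · exact H.upToScalar_unitary
  · exact H.symm.upToScalar_unitary

theorem sector_isMatchgate_iff (H : IsRotPair ε c s z ε' c' s' z') :
    UpToScalar IsMatchgate (sector l (rot ε c s z) (rot ε' c' s' z')) ↔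
      ε ^ 2 * (c ^ 2 + s ^ 2) = ε' ^ 2 * (c' ^ 2 + s' ^ 2) := by
  cases l
  · exact H.upToScalar_isMatchgate_iff
  · exact H.symm.upToScalar_isMatchgate_iff.trans eq_comm

theorem sector_isDualUnitary_iff (H : IsRotPair ε c s z ε' c' s' z') :
    UpToScalar IsDualUnitary (sector l (rot ε c s z) (rot ε' c' s' z')) ↔
      Complex.normSq ε * c ^ 2 = Complex.normSq ε' * s' ^ 2 ∧
        (c * c' = 0 ∨ (ε * conj ε').re = 0) := by
  cases l
  · exact H.upToScalar_isDualUnitary_iff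
  · refine H.symm.upToScalar_isDualUnitary_iff.trans ?_
    have e : ε' * conj ε = conj (ε * conj ε') := by simp [mul_comm]
    rw [e, Complex.conj_re, mul_comm c']
    have := H.eq
    exact and_congr_left fun _ => ⟨fun h => by linear_combination this + h,
      fun h => by linear_combination h - this⟩

theorem sector_isClifford_iff (H : IsRotPair ε c s z ε' c' s' z') :
    UpToScalar IsClifford (sector l (rot ε c s z) (rot ε' c' s' z')) ↔
      (ε * conj ε').re * (ε * conj ε').im = 0 ∧ CliffordRot c s z c' s' z' := by
  cases l
  · exact H.upToScalar_isClifford_iff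
  · refine H.symm.upToScalar_isClifford_iff.trans ?_
    have e : ε' * conj ε = conj (ε * conj ε') := by simp [mul_comm]
    rw [e, Complex.conj_re, Complex.conj_im, mul_neg, neg_eq_zero, cliffordRot_comm]

end IsRotPair

theorem isRotPair_of_smul_sector_ne_zero {l : BraidLabel} {M : TwoQubit} {k ε ε' z z' : ℂ}
    {c s c' s' : ℝ} (hM : M ≠ 0) (e : M = k • sector l (rot ε c s z) (rot ε' c' s' z'))
    (hz : z * conj z = 1) (hz' : z' * conj z' = 1)
    (h : Complex.normSq ε * (c ^ 2 + s ^ 2) = Complex.normSq ε' * (c' ^ 2 + s' ^ 2)) :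
    IsRotPair ε c s z ε' c' s' z' := by
  cases l
  · exact isRotPair_of_smul_ne_zero hM e hz hz' h
  · exact (isRotPair_of_smul_ne_zero hM e hz' hz h.symm).symm

/-- With the common phase factored out, the braid gate depends only on φ and ω. -/
theorem phase_params {φ₁ φ₂ φ₃ φ ω : ℝ} (hφ : φ = (φ₂ + φ₃) / 2 - φ₁) (hω : ω = (φ₂ - φ₃) / 2) :
    phase φ₁ = phase ((φ₂ + φ₃) / 2) * (phase φ)⁻¹ ∧
      phase φ₂ = phase ((φ₂ + φ₃) / 2) * phase ω ∧
      phase φ₃ = phase ((φ₂ + φ₃) / 2) * (phase ω)⁻¹ := by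
  rw [← phase_neg, ← phase_neg, ← phase_add, ← phase_add, ← phase_add]
  refine ⟨?_, ?_, ?_⟩ <;> congr 1 <;> linarith

/-- The scalar block is a multiple of e^{-iφ} - e^{iφ}x², which gives the factor sinh(μ + iφ),
written through its real and imaginary parts. -/
theorem gate1_eq (l : BraidLabel) {φ₁ φ₂ φ₃ φ ω : ℝ} (μ : ℝ) (hφ : φ = (φ₂ + φ₃) / 2 - φ₁)
    (hω : ω = (φ₂ - φ₃) / 2) :
    gate1 l φ₁ φ₂ φ₃ μ = (-2 * exp μ : ℂ) •
      sector l (rot ((sinh μ * cos φ : ℝ) + Complex.I * (cosh μ * sin φ : ℝ)) 1 0 1)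
        (rot Complex.I (sin φ) (sinh μ) (-Complex.I * phase ω)) := by
  obtain ⟨h1, h2, h3⟩ := phase_params hφ hω
  have hx : ((exp μ : ℝ) : ℂ) ≠ 0 := by exact_mod_cast (exp_pos μ).ne'
  have hs := phase_ne_zero ((φ₂ + φ₃) / 2)
  have ht := phase_ne_zero φ
  have hw := phase_ne_zero ω
  have cs := conj_phase ((φ₂ + φ₃) / 2)
  have ct := conj_phase φ
  have cw := conj_phase ω
  rw [gate1, braidGate_eq, ybThree, sector_conjTranspose, ← sector_one l, smul_sector, smul_sector,
    smul_sector, smul_sector, sector_add, sector_add, sector_inj]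
  simp only [ybAlpha, ybBeta, ybGamma, rot, sinh_eq, cosh_eq, exp_neg, Complex.ofReal_mul,
    ofReal_cos_eq, ofReal_sin_eq, h1, h2, h3, Complex.ofReal_div, Complex.ofReal_sub,
    Complex.ofReal_add, Complex.ofReal_inv, Complex.ofReal_ofNat]
  generalize phase φ = t, phase ω = w, phase ((φ₂ + φ₃) / 2) = s, ((exp μ : ℝ) : ℂ) = x at *
  constructor <;> ext i j <;> fin_cases i <;> fin_cases j <;> simp [cs, ct, cw] <;> field_simp <;>
    ring_nf <;> simp [Complex.I_sq] <;> ring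

theorem ofReal_exp_eq_sq (μ : ℝ) : ((exp μ : ℝ) : ℂ) = ((exp (μ / 2) : ℝ) : ℂ) ^ 2 := by
  rw [← Complex.ofReal_pow, ← Real.exp_nat_mul]
  congr 2
  push_cast; ring

theorem phase_eq_sq (φ : ℝ) : phase φ = phase (φ / 2) ^ 2 := by
  rw [pow_two, ← phase_add, add_halves]

/-- The scalar block is x - e^{-iφ}. Extracting square roots of x and of the phase leaves w =
sinh((μ + iφ)/2), and the other sector carries i times the conjugate of w. -/
theorem gate2_eq (l : BraidLabel) {φ₁ φ₂ φ₃ φ ω : ℝ} (μ : ℝ) (hφ : φ = (φ₂ + φ₃) / 2 - φ₁)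
    (hω : ω = (φ₂ - φ₃) / 2) :
    gate2 l φ₁ φ₂ φ₃ μ = (2 * exp (μ / 2) * (phase (φ / 2))⁻¹ : ℂ) •
      sector l (rot ((sinh (μ / 2) * cos (φ / 2) : ℝ) +
          Complex.I * (cosh (μ / 2) * sin (φ / 2) : ℝ)) 1 0 1)
        (rot (Complex.I * ((sinh (μ / 2) * cos (φ / 2) : ℝ) -
          Complex.I * (cosh (μ / 2) * sin (φ / 2) : ℝ))) 0 1 (-Complex.I * phase ω)) := by
  obtain ⟨h1, h2, h3⟩ := phase_params hφ hω
  have hx : ((exp (μ / 2) : ℝ) : ℂ) ≠ 0 := by exact_mod_cast (exp_pos _).ne'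
  have hs := phase_ne_zero ((φ₂ + φ₃) / 2)
  have ht := phase_ne_zero (φ / 2)
  have hw := phase_ne_zero ω
  have cs := conj_phase ((φ₂ + φ₃) / 2)
  have ct := conj_phase (φ / 2)
  have cw := conj_phase ω
  rw [gate2, braidGate_eq, ybTwo, sector_conjTranspose, smul_sector, smul_sector, smul_sector,
    sector_add, sector_inj]
  rw [phase_eq_sq φ] at h1
  rw [ofReal_exp_eq_sq]
  simp only [rot, sinh_eq, cosh_eq, exp_neg, Complex.ofReal_mul,
    ofReal_cos_eq, ofReal_sin_eq, h1, h2, h3, Complex.ofReal_div, Complex.ofReal_sub,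
    Complex.ofReal_add, Complex.ofReal_inv, Complex.ofReal_ofNat]
  generalize phase (φ / 2) = t, phase ω = w, phase ((φ₂ + φ₃) / 2) = s,
    ((exp (μ / 2) : ℝ) : ℂ) = x at *
  constructor <;> ext i j <;> fin_cases i <;> fin_cases j <;> simp [cs, ct, cw] <;> field_simp <;>
    ring_nf <;> simp [Complex.I_sq, Complex.I_pow_four] <;> ring

/-- The sign of λ₁ turns the difference of exponentials into a sum, so cosh((μ + iφ)/2) replaces the
hyperbolic sine. -/
theorem gate3_eq (l : BraidLabel) {φ₁ φ₂ φ₃ φ ω : ℝ} (μ : ℝ) (hφ : φ = (φ₂ + φ₃) / 2 - φ₁)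
    (hω : ω = (φ₂ - φ₃) / 2) :
    gate3 l φ₁ φ₂ φ₃ μ = (-2 * exp (μ / 2) * phase (φ / 2) : ℂ) •
      sector l (rot ((cosh (μ / 2) * cos (φ / 2) : ℝ) +
          Complex.I * (sinh (μ / 2) * sin (φ / 2) : ℝ)) 1 0 1)
        (rot (Complex.I * ((cosh (μ / 2) * cos (φ / 2) : ℝ) -
          Complex.I * (sinh (μ / 2) * sin (φ / 2) : ℝ))) 0 1 (-Complex.I * phase ω)) := by
  obtain ⟨h1, h2, h3⟩ := phase_params hφ hω
  have hx : ((exp (μ / 2) : ℝ) : ℂ) ≠ 0 := by exact_mod_cast (exp_pos _).ne'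
  have hs := phase_ne_zero ((φ₂ + φ₃) / 2)
  have ht := phase_ne_zero (φ / 2)
  have hw := phase_ne_zero ω
  have cs := conj_phase ((φ₂ + φ₃) / 2)
  have ct := conj_phase (φ / 2)
  have cw := conj_phase ω
  rw [gate3, braidGate_eq, ybTwo, sector_conjTranspose, smul_sector, smul_sector, smul_sector,
    sector_add, sector_inj]
  rw [phase_eq_sq φ] at h1
  rw [ofReal_exp_eq_sq]
  simp only [rot, sinh_eq, cosh_eq, exp_neg, Complex.ofReal_mul,
    ofReal_cos_eq, ofReal_sin_eq, h1, h2, h3, Complex.ofReal_div, Complex.ofReal_sub,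
    Complex.ofReal_add, Complex.ofReal_inv, Complex.ofReal_ofNat]
  generalize phase (φ / 2) = t, phase ω = w, phase ((φ₂ + φ₃) / 2) = s,
    ((exp (μ / 2) : ℝ) : ℂ) = x at *
  constructor <;> ext i j <;> fin_cases i <;> fin_cases j <;> simp [cs, ct, cw] <;> field_simp <;>
    ring_nf <;> simp [Complex.I_sq, Complex.I_pow_four] <;> ring

/-- With w = μ/2 + iφ₁, the first block has factor sinh w and parameters Re cosh w, Im cosh w; the
second has factor i cosh w and parameters Im sinh w, Re sinh w. Both norms are |sinh w|²|cosh w|².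
-/
theorem gateIII1_eq (φ₁ φ₂ μ : ℝ) :
    gateIII1 φ₁ φ₂ μ = (-4 * exp μ : ℂ) •
      xType (rot ((sinh (μ / 2) * cos φ₁ : ℝ) + Complex.I * (cosh (μ / 2) * sin φ₁ : ℝ))
          (cosh (μ / 2) * cos φ₁) (sinh (μ / 2) * sin φ₁) (-phase φ₂))
        (rot (Complex.I *
            ((cosh (μ / 2) * cos φ₁ : ℝ) + Complex.I * (sinh (μ / 2) * sin φ₁ : ℝ)))
          (cosh (μ / 2) * sin φ₁) (sinh (μ / 2) * cos φ₁) Complex.I) := by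
  have hx : ((exp (μ / 2) : ℝ) : ℂ) ≠ 0 := by exact_mod_cast (exp_pos _).ne'
  have hp := phase_ne_zero φ₁
  have hz := phase_ne_zero φ₂
  have cp := conj_phase φ₁
  have cz := conj_phase φ₂
  rw [gateIII1, braidIII_eq, ybThree, xType_conjTranspose, ← xType_one, smul_xType, smul_xType,
    smul_xType, smul_xType, xType_add, xType_add, xType_inj, ofReal_exp_eq_sq]
  simp only [ybAlpha, ybBeta, ybGamma, rot, sinh_eq, cosh_eq, exp_neg, Complex.ofReal_mul,
    ofReal_cos_eq, ofReal_sin_eq, phase_neg, Complex.ofReal_div, Complex.ofReal_sub,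
    Complex.ofReal_add, Complex.ofReal_inv, Complex.ofReal_ofNat]
  generalize phase φ₁ = p, phase φ₂ = z, ((exp (μ / 2) : ℝ) : ℂ) = x at *
  constructor <;> ext i j <;> fin_cases i <;> fin_cases j <;> simp [cp, cz] <;> field_simp <;>
    ring_nf <;> simp [Complex.I_sq, Complex.I_pow_four] <;> ring

/-- The real parameters are the real and imaginary parts of sinh(μ/2 + iφ₁), exchanged between the
sectors. -/
theorem gateIII2_eq (φ₁ φ₂ μ : ℝ) :
    gateIII2 φ₁ φ₂ μ = (2 * exp (μ / 2) * (phase φ₁)⁻¹ : ℂ) •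
      xType (rot 1 (sinh (μ / 2) * cos φ₁) (cosh (μ / 2) * sin φ₁) (-phase φ₂))
        (rot Complex.I (cosh (μ / 2) * sin φ₁) (sinh (μ / 2) * cos φ₁) Complex.I) := by
  have hx : ((exp (μ / 2) : ℝ) : ℂ) ≠ 0 := by exact_mod_cast (exp_pos _).ne'
  have hp := phase_ne_zero φ₁
  have hz := phase_ne_zero φ₂
  have cp := conj_phase φ₁
  have cz := conj_phase φ₂
  rw [gateIII2, braidIII_eq, ybTwo, xType_conjTranspose, smul_xType, smul_xType,
    smul_xType, xType_add, xType_inj, ofReal_exp_eq_sq]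
  simp only [rot, sinh_eq, cosh_eq, exp_neg, Complex.ofReal_mul,
    ofReal_cos_eq, ofReal_sin_eq, phase_neg, Complex.ofReal_div, Complex.ofReal_sub,
    Complex.ofReal_add, Complex.ofReal_inv, Complex.ofReal_ofNat]
  generalize phase φ₁ = p, phase φ₂ = z, ((exp (μ / 2) : ℝ) : ℂ) = x at *
  constructor <;> ext i j <;> fin_cases i <;> fin_cases j <;> simp [cp, cz] <;> field_simp <;>
    ring_nf <;> simp [Complex.I_sq] <;> ring

/-- Same form, with the real and imaginary parts of cosh(μ/2 + iφ₁). -/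
theorem gateIII3_eq (φ₁ φ₂ μ : ℝ) :
    gateIII3 φ₁ φ₂ μ = (-2 * exp (μ / 2) * phase φ₁ : ℂ) •
      xType (rot 1 (cosh (μ / 2) * cos φ₁) (sinh (μ / 2) * sin φ₁) (-phase φ₂))
        (rot Complex.I (sinh (μ / 2) * sin φ₁) (cosh (μ / 2) * cos φ₁) Complex.I) := by
  have hx : ((exp (μ / 2) : ℝ) : ℂ) ≠ 0 := by exact_mod_cast (exp_pos _).ne'
  have hp := phase_ne_zero φ₁
  have hz := phase_ne_zero φ₂
  have cp := conj_phase φ₁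
  have cz := conj_phase φ₂
  rw [gateIII3, braidIII_eq, ybTwo, xType_conjTranspose, smul_xType, smul_xType,
    smul_xType, xType_add, xType_inj, ofReal_exp_eq_sq]
  simp only [rot, sinh_eq, cosh_eq, exp_neg, Complex.ofReal_mul,
    ofReal_cos_eq, ofReal_sin_eq, phase_neg, Complex.ofReal_div, Complex.ofReal_sub,
    Complex.ofReal_add, Complex.ofReal_inv, Complex.ofReal_ofNat]
  generalize phase φ₁ = p, phase φ₂ = z, ((exp (μ / 2) : ℝ) : ℂ) = x at *
  constructor <;> ext i j <;> fin_cases i <;> fin_cases j <;> simp [cp, cz] <;> field_simp <;>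
    ring_nf <;> simp [Complex.I_sq] <;> ring

theorem gateIV_eq_rot (φ₁ χ : ℝ) :
    gateIV φ₁ χ = xType (rot 1 (cos χ) (sin χ) (phase φ₁)) (rot 1 (cos χ) (sin χ) 1) := by
  simp [gateIV, xType, rot, conj_phase, phase_neg]

theorem braidGate_eq_rot (l : BraidLabel) (φ₁ φ₂ φ₃ : ℝ) :
    (phase ((φ₂ + φ₃) / 2))⁻¹ • braidGate l φ₁ φ₂ φ₃ =
      sector l (rot (phase (φ₁ - (φ₂ + φ₃) / 2)) 1 0 1)
        (rot Complex.I 0 1 (-Complex.I * phase ((φ₂ - φ₃) / 2))) := by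
  have h2 : phase φ₂ = phase ((φ₂ + φ₃) / 2) * phase ((φ₂ - φ₃) / 2) := by
    rw [← phase_add]; congr 1; ring
  have h3 : phase φ₃ = phase ((φ₂ + φ₃) / 2) * (phase ((φ₂ - φ₃) / 2))⁻¹ := by
    rw [← phase_neg, ← phase_add]; congr 1; ring
  have hs := phase_ne_zero ((φ₂ + φ₃) / 2)
  have cw := conj_phase ((φ₂ - φ₃) / 2)
  rw [braidGate_eq, smul_sector, sector_inj, sub_eq_add_neg, phase_add, phase_neg, h2, h3]
  constructor <;> ext i j <;> fin_cases i <;> fin_cases j <;> simp [rot, cw, mul_comm] <;>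
    field_simp <;> simp [neg_div]

theorem braidIII_eq_rot (φ₁ φ₂ : ℝ) :
    (phase φ₁)⁻¹ • braidIII φ₁ φ₂ =
      xType (rot (phase (-φ₁)) (cos φ₁) (sin φ₁) (phase φ₂))
        (rot (-Complex.I * phase (-φ₁)) (sin φ₁) (cos φ₁) (-Complex.I)) := by
  have cz := conj_phase φ₂
  rw [braidIII_eq, smul_xType, xType_inj, phase_neg, phase_neg]
  constructor <;> ext i j <;> fin_cases i <;> fin_cases j <;> simp [rot, cz] <;> ring_nf <;>
    simp [Complex.I_sq]

/-! ### Classification of the gates -/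

theorem neg_I_mul_phase_mul_conj (ω : ℝ) :
    -Complex.I * phase ω * conj (-Complex.I * phase ω) = 1 := by
  have := phase_mul_conj ω
  simp only [map_mul, map_neg, Complex.conj_I]
  linear_combination this - (phase ω * conj (phase ω)) * Complex.I_sq

theorem neg_I_mul_phase_pow_four (ω : ℝ) : (-Complex.I * phase ω) ^ 4 = phase ω ^ 4 := by
  rw [mul_pow, Even.neg_pow (by decide), Complex.I_pow_four, one_mul]

/-! ### Two-term gates for labels I and II, with w = u + iv. -/

section TwoTerm

variable {l : BraidLabel} {u v ω : ℝ}

/-- The relative phase is that of -iw², so w² must be real or imaginary: uv(u² - v²) = 0. One block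
is diagonal and the other antidiagonal, which leaves only the condition on the phase e^{iω}. -/
theorem isClifford_twoTerm_iff
    (H : IsRotPair (u + Complex.I * v) 1 0 1 (Complex.I * (u - Complex.I * v)) 0 1
      (-Complex.I * phase ω)) :
    UpToScalar IsClifford (sector l (rot (u + Complex.I * v) 1 0 1)
      (rot (Complex.I * (u - Complex.I * v)) 0 1 (-Complex.I * phase ω))) ↔
      IsIntMul ω (π / 2) ∧ (u * v = 0 ∨ u ^ 2 = v ^ 2) := by
  have e : ((u + Complex.I * v) * conj (Complex.I * (u - Complex.I * v))).re *
      ((u + Complex.I * v) * conj (Complex.I * (u - Complex.I * v))).im =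
      -2 * ((u * v) * (u ^ 2 - v ^ 2)) := by
    simp; ring
  rw [H.sector_isClifford_iff, e, CliffordRot, neg_I_mul_phase_pow_four, phase_pow_four_iff,
    mul_eq_zero, mul_eq_zero, sub_eq_zero]
  simp [and_comm]

/-- The determinants agree when w² = -w̄², that is, when Re w² = 0. -/
theorem isMatchgate_twoTerm_iff
    (H : IsRotPair (u + Complex.I * v) 1 0 1 (Complex.I * (u - Complex.I * v)) 0 1
      (-Complex.I * phase ω)) :
    UpToScalar IsMatchgate (sector l (rot (u + Complex.I * v) 1 0 1)
      (rot (Complex.I * (u - Complex.I * v)) 0 1 (-Complex.I * phase ω))) ↔ u ^ 2 = v ^ 2 := by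
  rw [H.sector_isMatchgate_iff, Complex.ext_iff]
  simp [pow_two]
  constructor
  · rintro ⟨h, -⟩
    linarith
  · intro h
    constructor <;> linarith

theorem isDualUnitary_twoTerm
    (H : IsRotPair (u + Complex.I * v) 1 0 1 (Complex.I * (u - Complex.I * v)) 0 1
      (-Complex.I * phase ω)) :
    UpToScalar IsDualUnitary (sector l (rot (u + Complex.I * v) 1 0 1)
      (rot (Complex.I * (u - Complex.I * v)) 0 1 (-Complex.I * phase ω))) := by
  rw [H.sector_isDualUnitary_iff]
  simp [Complex.normSq_apply, add_comm]

theorem isRotPair_twoTerm {M : TwoQubit} {k : ℂ} (hM : M ≠ 0)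
    (e : M = k • sector l (rot (u + Complex.I * v) 1 0 1)
      (rot (Complex.I * (u - Complex.I * v)) 0 1 (-Complex.I * phase ω))) :
    IsRotPair (u + Complex.I * v) 1 0 1 (Complex.I * (u - Complex.I * v)) 0 1
      (-Complex.I * phase ω) :=
  isRotPair_of_smul_sector_ne_zero hM e (by simp) (neg_I_mul_phase_mul_conj ω)
    (by simp [Complex.normSq_apply, add_comm])

end TwoTerm

/-! ### Two-term gates for label III, with relative phase fixed to -i. -/

section BraidIII

variable {c s φ₂ : ℝ}

theorem neg_phase_mul_conj (θ : ℝ) : -phase θ * conj (-phase θ) = 1 := by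
  rw [map_neg, neg_mul_neg, phase_mul_conj]

theorem isRotPair_III {M : TwoQubit} {k : ℂ} (hM : M ≠ 0)
    (e : M = k • xType (rot 1 c s (-phase φ₂)) (rot Complex.I s c Complex.I)) :
    IsRotPair 1 c s (-phase φ₂) Complex.I s c Complex.I :=
  isRotPair_of_smul_ne_zero hM e (neg_phase_mul_conj φ₂) (by simp) (by simp [add_comm])

/-- The sectors carry (c, s) and (s, c), so the cases of `CliffordRot` with s = s' = 0 or c = c' = 0
would make the gate vanish. In the balanced case z'² = z² with z' = i reads e^{2iφ₂} = -1. -/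
theorem isClifford_III_iff (H : IsRotPair 1 c s (-phase φ₂) Complex.I s c Complex.I) :
    UpToScalar IsClifford (xType (rot 1 c s (-phase φ₂)) (rot Complex.I s c Complex.I)) ↔
      s = 0 ∨ (c = 0 ∧ IsIntMul φ₂ (π / 2)) ∨ (c ^ 2 = s ^ 2 ∧ IsIntMul (φ₂ - π / 2) π) := by
  have hpos := H.sq_add_sq_pos
  have hcs : ¬ (c = 0 ∧ s = 0) := by
    rintro ⟨rfl, rfl⟩
    simp at hpos
  have h4 : (-1 = phase φ₂ ^ 2 ∧ phase φ₂ ^ 4 = 1) ↔ phase φ₂ ^ 2 = -1 := by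
    refine ⟨fun h => h.1.symm, fun h => ⟨h.symm, ?_⟩⟩
    linear_combination (phase φ₂ ^ 2 - 1) * h
  have hc : (c ^ 2 = s ^ 2 ∧ s ^ 2 = c ^ 2 ∧ phase φ₂ ^ 2 = -1) ↔
      (c ^ 2 = s ^ 2 ∧ phase φ₂ ^ 2 = -1) :=
    ⟨fun h => ⟨h.1, h.2.2⟩, fun h => ⟨h.1, h.1.symm, h.2⟩⟩
  rw [H.upToScalar_isClifford_iff, CliffordRot, ← phase_pow_four_iff, ← phase_sq_eq_neg_one_iff,
    Even.neg_pow (by decide : Even 4), neg_sq, Complex.I_sq, h4, hc]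
  have h1 : ((1 : ℂ) * conj Complex.I).re * ((1 : ℂ) * conj Complex.I).im = 0 := by simp
  simp only [h1, true_and, Complex.I_pow_four]
  tauto

/-- The determinants are c² + s² and its negative. -/
theorem not_isMatchgate_III (H : IsRotPair 1 c s (-phase φ₂) Complex.I s c Complex.I) :
    ¬ UpToScalar IsMatchgate
      (xType (rot 1 c s (-phase φ₂)) (rot Complex.I s c Complex.I)) := by
  rw [H.upToScalar_isMatchgate_iff, Complex.I_sq]
  intro h
  have h' : (c ^ 2 + s ^ 2 : ℝ) = -(s ^ 2 + c ^ 2) := by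
    have : ((c ^ 2 + s ^ 2 : ℝ) : ℂ) = ((-(s ^ 2 + c ^ 2) : ℝ) : ℂ) := by
      push_cast; linear_combination h
    exact_mod_cast this
  have := H.sq_add_sq_pos
  linarith

theorem isDualUnitary_III (H : IsRotPair 1 c s (-phase φ₂) Complex.I s c Complex.I) :
    UpToScalar IsDualUnitary (xType (rot 1 c s (-phase φ₂)) (rot Complex.I s c Complex.I)) := by
  rw [H.upToScalar_isDualUnitary_iff]
  simp

end BraidIII

theorem exp_ofReal_ne_zero (μ : ℝ) : ((exp μ : ℝ) : ℂ) ≠ 0 := by exact_mod_cast (exp_pos μ).ne'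

/-! ### Three-term gates for labels I and II, with C, S, ch, sh standing for cos φ, sin φ, cosh μ,
sinh μ. -/

section ThreeTerm

variable {l : BraidLabel} {C S ch sh ω : ℝ}

/-- Equality of norms is |sinh(μ + iφ)|² = sinh²μ + sin²φ. -/
theorem isRotPair_threeTerm {M : TwoQubit} {k : ℂ} (hsc : S ^ 2 + C ^ 2 = 1)
    (hch : ch ^ 2 = sh ^ 2 + 1) (hM : M ≠ 0)
    (e : M = k • sector l (rot ((sh * C : ℝ) + Complex.I * (ch * S : ℝ)) 1 0 1)
      (rot Complex.I S sh (-Complex.I * phase ω))) :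
    IsRotPair ((sh * C : ℝ) + Complex.I * (ch * S : ℝ)) 1 0 1 Complex.I S sh
      (-Complex.I * phase ω) :=
  isRotPair_of_smul_sector_ne_zero hM e (by simp) (neg_I_mul_phase_mul_conj ω) (by
    simp [Complex.normSq_apply]
    linear_combination sh ^ 2 * hsc + S ^ 2 * hch)

theorem isClifford_threeTerm_iff
    (H : IsRotPair ((sh * C : ℝ) + Complex.I * (ch * S : ℝ)) 1 0 1 Complex.I S sh
      (-Complex.I * phase ω)) :
    UpToScalar IsClifford (sector l (rot ((sh * C : ℝ) + Complex.I * (ch * S : ℝ)) 1 0 1)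
      (rot Complex.I S sh (-Complex.I * phase ω))) ↔
      sh = 0 ∨ (S = 0 ∧ IsIntMul ω (π / 2)) := by
  have e : (((sh * C : ℝ) + Complex.I * (ch * S : ℝ)) * conj Complex.I).re *
      (((sh * C : ℝ) + Complex.I * (ch * S : ℝ)) * conj Complex.I).im = -(sh * S * C * ch) := by
    simp; ring
  rw [H.sector_isClifford_iff, e, CliffordRot, neg_I_mul_phase_pow_four, phase_pow_four_iff]
  simp
  tauto

/-- The determinant condition is ε² = -|ε|², so ε = sinh(μ + iφ) is purely imaginary and its real
part sh·C vanishes. -/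
theorem isMatchgate_threeTerm_iff (hsc : S ^ 2 + C ^ 2 = 1) (hch : ch ^ 2 = sh ^ 2 + 1)
    (H : IsRotPair ((sh * C : ℝ) + Complex.I * (ch * S : ℝ)) 1 0 1 Complex.I S sh
      (-Complex.I * phase ω)) :
    UpToScalar IsMatchgate (sector l (rot ((sh * C : ℝ) + Complex.I * (ch * S : ℝ)) 1 0 1)
      (rot Complex.I S sh (-Complex.I * phase ω))) ↔ sh = 0 ∨ C = 0 := by
  rw [H.sector_isMatchgate_iff, Complex.ext_iff]
  simp [pow_two]
  constructor
  · rintro ⟨h, -⟩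
    have : (sh * C) ^ 2 = 0 := by
      linear_combination h / 2 + S ^ 2 * hch / 2 + sh ^ 2 * hsc / 2
    simpa using this
  · intro h
    have h0 : sh * C = 0 := by simpa using h
    constructor
    · linear_combination 2 * sh * C * h0 - S ^ 2 * hch - sh ^ 2 * hsc
    · linear_combination 2 * ch * S * h0

theorem isDualUnitary_threeTerm_iff (hsc : S ^ 2 + C ^ 2 = 1) (hch : ch ^ 2 = sh ^ 2 + 1)
    (H : IsRotPair ((sh * C : ℝ) + Complex.I * (ch * S : ℝ)) 1 0 1 Complex.I S sh
      (-Complex.I * phase ω)) :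
    UpToScalar IsDualUnitary (sector l (rot ((sh * C : ℝ) + Complex.I * (ch * S : ℝ)) 1 0 1)
      (rot Complex.I S sh (-Complex.I * phase ω))) ↔ S = 0 := by
  rw [H.sector_isDualUnitary_iff]
  simp [Complex.normSq_apply]
  constructor
  · rintro ⟨h, -⟩
    have : S ^ 2 = 0 := by linear_combination h - sh ^ 2 * hsc - S ^ 2 * hch
    simpa using this
  · rintro rfl
    exact ⟨by linear_combination sh ^ 2 * hsc, .inl rfl⟩

/-- The off-diagonal entry e^{iω}sh must vanish; then ch = 1 and both blocks are the scalar iS. -/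
theorem exists_threeTerm_eq_smul_one_iff (hch : ch ^ 2 = sh ^ 2 + 1) (hpos : 0 < ch) :
    (∃ c : ℂ, sector l (rot ((sh * C : ℝ) + Complex.I * (ch * S : ℝ)) 1 0 1)
      (rot Complex.I S sh (-Complex.I * phase ω)) = c • (1 : TwoQubit)) ↔ sh = 0 := by
  rw [← sector_one l]
  simp only [smul_sector, sector_inj]
  constructor
  · rintro ⟨c, -, h⟩
    have := congrFun (congrFun h 0) 1
    simpa [rot, phase_ne_zero] using this
  · rintro rfl
    have h1 : ch = 1 := by nlinarith
    subst h1
    refine ⟨Complex.I * S, ?_, ?_⟩ <;> ext i j <;> fin_cases i <;> fin_cases j <;> simp [rot]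

end ThreeTerm

theorem gate1_classification (l : BraidLabel) {φ₁ φ₂ φ₃ φ ω μ : ℝ}
    (hφ : φ = (φ₂ + φ₃) / 2 - φ₁) (hω : ω = (φ₂ - φ₃) / 2) (hM : gate1 l φ₁ φ₂ φ₃ μ ≠ 0) :
    UpToScalar (· ∈ Matrix.unitaryGroup (Fin 2 × Fin 2) ℂ) (gate1 l φ₁ φ₂ φ₃ μ) ∧
      (UpToScalar IsClifford (gate1 l φ₁ φ₂ φ₃ μ) ↔
        μ = 0 ∨ (IsIntMul φ π ∧ IsIntMul ω (π / 2))) ∧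
      (UpToScalar IsMatchgate (gate1 l φ₁ φ₂ φ₃ μ) ↔ μ = 0 ∨ IsIntMul (φ - π / 2) π) ∧
      (UpToScalar IsNontrivialMatchgate (gate1 l φ₁ φ₂ φ₃ μ) ↔
        μ ≠ 0 ∧ IsIntMul (φ - π / 2) π) ∧
      (UpToScalar IsDualUnitary (gate1 l φ₁ φ₂ φ₃ μ) ↔ IsIntMul φ π) := by
  have e := gate1_eq l μ hφ hω
  have hk : (-2 * exp μ : ℂ) ≠ 0 := mul_ne_zero (by norm_num) (exp_ofReal_ne_zero μ)
  have hsc := sin_sq_add_cos_sq φ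
  have hch := cosh_sq μ
  have H := isRotPair_threeTerm hsc hch hM e
  rw [upToScalar_isNontrivialMatchgate_iff, e, upToScalar_smul hk, upToScalar_smul hk,
    upToScalar_smul hk, upToScalar_smul hk, isClifford_threeTerm_iff H,
    isMatchgate_threeTerm_iff hsc hch H, isDualUnitary_threeTerm_iff hsc hch H,
    isIntMul_sub_pi_div_two_iff, isIntMul_pi_iff, sinh_eq_zero]
  have hscalar : (∃ c : ℂ, (-2 * exp μ : ℂ) •
      sector l (rot ((sinh μ * cos φ : ℝ) + Complex.I * (cosh μ * sin φ : ℝ)) 1 0 1)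
        (rot Complex.I (sin φ) (sinh μ) (-Complex.I * phase ω)) = c • (1 : TwoQubit)) ↔ μ = 0 := by
    rw [← sinh_eq_zero,
      ← exists_threeTerm_eq_smul_one_iff (l := l) (C := cos φ) (S := sin φ) (ω := ω) hch
        (cosh_pos μ)]
    constructor
    · rintro ⟨c, h⟩
      exact ⟨(-2 * exp μ : ℂ)⁻¹ * c, by rw [← smul_smul, ← h, inv_smul_smul₀ hk]⟩
    · rintro ⟨c, h⟩
      exact ⟨(-2 * exp μ : ℂ) * c, by rw [h, smul_smul]⟩
  rw [hscalar]
  exact ⟨H.sector_upToScalar_unitary, Iff.rfl, Iff.rfl, by tauto, Iff.rfl⟩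

theorem gate2_classification (l : BraidLabel) {φ₁ φ₂ φ₃ φ ω μ : ℝ}
    (hφ : φ = (φ₂ + φ₃) / 2 - φ₁) (hω : ω = (φ₂ - φ₃) / 2) (hM : gate2 l φ₁ φ₂ φ₃ μ ≠ 0) :
    (UpToScalar IsClifford (gate2 l φ₁ φ₂ φ₃ μ) ↔
        IsIntMul ω (π / 2) ∧ (μ = 0 ∨ IsIntMul φ π ∨
          (cos (φ / 2) ≠ 0 ∧ (tanh (μ / 2) = tan (φ / 2) ∨ tanh (μ / 2) = -tan (φ / 2))))) ∧
      (UpToScalar IsMatchgate (gate2 l φ₁ φ₂ φ₃ μ) ↔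
        cos (φ / 2) ≠ 0 ∧ (tanh (μ / 2) = tan (φ / 2) ∨ tanh (μ / 2) = -tan (φ / 2))) ∧
      UpToScalar IsDualUnitary (gate2 l φ₁ φ₂ φ₃ μ) := by
  have e := gate2_eq l μ hφ hω
  have hk : (2 * exp (μ / 2) * (phase (φ / 2))⁻¹ : ℂ) ≠ 0 :=
    mul_ne_zero (mul_ne_zero two_ne_zero (exp_ofReal_ne_zero _)) (inv_ne_zero (phase_ne_zero _))
  have H := isRotPair_twoTerm hM e
  have hφ2 : sin φ = 2 * sin (φ / 2) * cos (φ / 2) := by rw [← sin_two_mul]; congr 1; ring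
  rw [e, upToScalar_smul hk, upToScalar_smul hk, upToScalar_smul hk, isClifford_twoTerm_iff H,
    isMatchgate_twoTerm_iff H, tanh_eq_tan_iff, isIntMul_pi_iff, hφ2, mul_pow, mul_pow]
  refine ⟨?_, Iff.rfl, isDualUnitary_twoTerm H⟩
  simp [(cosh_pos (μ / 2)).ne']
  tauto

theorem gate3_classification (l : BraidLabel) {φ₁ φ₂ φ₃ φ ω μ : ℝ}
    (hφ : φ = (φ₂ + φ₃) / 2 - φ₁) (hω : ω = (φ₂ - φ₃) / 2) (hM : gate3 l φ₁ φ₂ φ₃ μ ≠ 0) :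
    (UpToScalar IsClifford (gate3 l φ₁ φ₂ φ₃ μ) ↔
        IsIntMul ω (π / 2) ∧ (μ = 0 ∨ IsIntMul φ π ∨
          (sin (φ / 2) ≠ 0 ∧ (tanh (μ / 2) = cot (φ / 2) ∨ tanh (μ / 2) = -cot (φ / 2))))) ∧
      (UpToScalar IsMatchgate (gate3 l φ₁ φ₂ φ₃ μ) ↔
        sin (φ / 2) ≠ 0 ∧ (tanh (μ / 2) = cot (φ / 2) ∨ tanh (μ / 2) = -cot (φ / 2))) ∧
      UpToScalar IsDualUnitary (gate3 l φ₁ φ₂ φ₃ μ) := by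
  have e := gate3_eq l μ hφ hω
  have hk : (-2 * exp (μ / 2) * phase (φ / 2) : ℂ) ≠ 0 :=
    mul_ne_zero (mul_ne_zero (by norm_num) (exp_ofReal_ne_zero _)) (phase_ne_zero _)
  have H := isRotPair_twoTerm hM e
  have hφ2 : sin φ = 2 * sin (φ / 2) * cos (φ / 2) := by rw [← sin_two_mul]; congr 1; ring
  rw [e, upToScalar_smul hk, upToScalar_smul hk, upToScalar_smul hk, isClifford_twoTerm_iff H,
    isMatchgate_twoTerm_iff H, tanh_eq_cot_iff, isIntMul_pi_iff, hφ2, mul_pow, mul_pow,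
    eq_comm (a := cosh (μ / 2) ^ 2 * cos (φ / 2) ^ 2)]
  refine ⟨?_, Iff.rfl, isDualUnitary_twoTerm H⟩
  simp [(cosh_pos (μ / 2)).ne']
  tauto

theorem gateIII2_classification {φ₁ φ₂ μ : ℝ} (hM : gateIII2 φ₁ φ₂ μ ≠ 0) :
    (UpToScalar IsClifford (gateIII2 φ₁ φ₂ μ) ↔
        IsIntMul φ₁ π ∨
        ((μ = 0 ∨ IsIntMul (φ₁ - π / 2) π) ∧ IsIntMul φ₂ (π / 2)) ∨
        (cos φ₁ ≠ 0 ∧ (tanh (μ / 2) = tan φ₁ ∨ tanh (μ / 2) = -tan φ₁) ∧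
          IsIntMul (φ₂ - π / 2) π)) ∧
      ¬ UpToScalar IsMatchgate (gateIII2 φ₁ φ₂ μ) ∧
      UpToScalar IsDualUnitary (gateIII2 φ₁ φ₂ μ) := by
  have e := gateIII2_eq φ₁ φ₂ μ
  have hk : (2 * exp (μ / 2) * (phase φ₁)⁻¹ : ℂ) ≠ 0 :=
    mul_ne_zero (mul_ne_zero two_ne_zero (exp_ofReal_ne_zero _)) (inv_ne_zero (phase_ne_zero _))
  have H := isRotPair_III hM e
  rw [e, upToScalar_smul hk, upToScalar_smul hk, upToScalar_smul hk, isClifford_III_iff H,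
    ← and_assoc (a := cos φ₁ ≠ 0), tanh_eq_tan_iff, isIntMul_pi_iff (t := φ₁),
    isIntMul_sub_pi_div_two_iff (t := φ₁), mul_pow, mul_pow]
  refine ⟨?_, not_isMatchgate_III H, isDualUnitary_III H⟩
  simp [(cosh_pos (μ / 2)).ne']

theorem gateIII3_classification {φ₁ φ₂ μ : ℝ} (hM : gateIII3 φ₁ φ₂ μ ≠ 0) :
    (UpToScalar IsClifford (gateIII3 φ₁ φ₂ μ) ↔
        μ = 0 ∨ IsIntMul φ₁ π ∨
        (IsIntMul (φ₁ - π / 2) π ∧ IsIntMul φ₂ (π / 2)) ∨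
        (sin φ₁ ≠ 0 ∧ (tanh (μ / 2) = cot φ₁ ∨ tanh (μ / 2) = -cot φ₁) ∧
          IsIntMul (φ₂ - π / 2) π)) ∧
      ¬ UpToScalar IsMatchgate (gateIII3 φ₁ φ₂ μ) ∧
      UpToScalar IsDualUnitary (gateIII3 φ₁ φ₂ μ) := by
  have e := gateIII3_eq φ₁ φ₂ μ
  have hk : (-2 * exp (μ / 2) * phase φ₁ : ℂ) ≠ 0 :=
    mul_ne_zero (mul_ne_zero (by norm_num) (exp_ofReal_ne_zero _)) (phase_ne_zero _)
  have H := isRotPair_III hM e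
  rw [e, upToScalar_smul hk, upToScalar_smul hk, upToScalar_smul hk, isClifford_III_iff H,
    ← and_assoc (a := sin φ₁ ≠ 0), tanh_eq_cot_iff, isIntMul_pi_iff (t := φ₁),
    isIntMul_sub_pi_div_two_iff (t := φ₁), mul_pow, mul_pow,
    eq_comm (a := cosh (μ / 2) ^ 2 * cos φ₁ ^ 2)]
  refine ⟨?_, not_isMatchgate_III H, isDualUnitary_III H⟩
  simp [(cosh_pos (μ / 2)).ne', or_assoc]

/-! ### The three-term gate for label III, with hyperbolic functions taken at μ/2. -/

section BraidIIIThreeTerm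

variable {C S ch sh φ₂ : ℝ}

theorem isRotPair_III_threeTerm {M : TwoQubit} {k : ℂ} (hM : M ≠ 0)
    (e : M = k • xType
      (rot ((sh * C : ℝ) + Complex.I * (ch * S : ℝ)) (ch * C) (sh * S) (-phase φ₂))
      (rot (Complex.I * ((ch * C : ℝ) + Complex.I * (sh * S : ℝ))) (ch * S) (sh * C) Complex.I)) :
    IsRotPair ((sh * C : ℝ) + Complex.I * (ch * S : ℝ)) (ch * C) (sh * S) (-phase φ₂)
      (Complex.I * ((ch * C : ℝ) + Complex.I * (sh * S : ℝ))) (ch * S) (sh * C) Complex.I :=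
  isRotPair_of_smul_ne_zero hM e (neg_phase_mul_conj φ₂) (by simp) (by
    simp [Complex.normSq_apply]
    ring)

/-- The balanced case is excluded: adding c² = s² and c'² = s'² gives cosh² = sinh². In the
surviving cases Re · Im = -sh·ch·C·S vanishes by itself. -/
theorem isClifford_III_threeTerm_iff (hsc : S ^ 2 + C ^ 2 = 1)
    (hch : ch ^ 2 = sh ^ 2 + 1) (hpos : 0 < ch)
    (H : IsRotPair ((sh * C : ℝ) + Complex.I * (ch * S : ℝ)) (ch * C) (sh * S) (-phase φ₂)
      (Complex.I * ((ch * C : ℝ) + Complex.I * (sh * S : ℝ))) (ch * S) (sh * C) Complex.I) :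
    UpToScalar IsClifford (xType
      (rot ((sh * C : ℝ) + Complex.I * (ch * S : ℝ)) (ch * C) (sh * S) (-phase φ₂))
      (rot (Complex.I * ((ch * C : ℝ) + Complex.I * (sh * S : ℝ))) (ch * S) (sh * C)
        Complex.I)) ↔
      sh = 0 ∨ S = 0 ∨ (C = 0 ∧ IsIntMul φ₂ (π / 2)) := by
  have e : (((sh * C : ℝ) + Complex.I * (ch * S : ℝ)) *
        conj (Complex.I * ((ch * C : ℝ) + Complex.I * (sh * S : ℝ)))).re *
      (((sh * C : ℝ) + Complex.I * (ch * S : ℝ)) *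
        conj (Complex.I * ((ch * C : ℝ) + Complex.I * (sh * S : ℝ)))).im =
      -(sh * ch * C * S) := by
    simp
    linear_combination (sh * ch * C * S) * ((sh ^ 2 - ch ^ 2) * hsc - hch)
  have h5 : ¬ ((ch * C) ^ 2 = (sh * S) ^ 2 ∧ (ch * S) ^ 2 = (sh * C) ^ 2) := by
    rintro ⟨h1, h2⟩
    have : (1 : ℝ) = 0 := by
      linear_combination h1 + h2 - hch + (sh ^ 2 - ch ^ 2) * hsc
    exact one_ne_zero this
  have h4 : ¬ (C = 0 ∧ S = 0) := by
    rintro ⟨rfl, rfl⟩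
    simp at hsc
  rw [H.upToScalar_isClifford_iff, e, CliffordRot, ← and_assoc (a := (ch * C) ^ 2 = _),
    Even.neg_pow (by decide : Even 4), phase_pow_four_iff]
  simp only [h5, Complex.I_pow_four, neg_eq_zero, mul_eq_zero, hpos.ne']
  tauto

/-- With w = μ/2 + iφ₁ the condition is sinh²w |cosh w|² = -cosh²w |sinh w|². Its real and imaginary
parts give sh²(C² - S²) = 0 and sh·C·S = 0, and (C² - S²)² + 4C²S² = 1 then forces sh = 0. -/
theorem isMatchgate_III_threeTerm_iff (hsc : S ^ 2 + C ^ 2 = 1)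
    (hch : ch ^ 2 = sh ^ 2 + 1) (hpos : 0 < ch)
    (H : IsRotPair ((sh * C : ℝ) + Complex.I * (ch * S : ℝ)) (ch * C) (sh * S) (-phase φ₂)
      (Complex.I * ((ch * C : ℝ) + Complex.I * (sh * S : ℝ))) (ch * S) (sh * C) Complex.I) :
    UpToScalar IsMatchgate (xType
      (rot ((sh * C : ℝ) + Complex.I * (ch * S : ℝ)) (ch * C) (sh * S) (-phase φ₂))
      (rot (Complex.I * ((ch * C : ℝ) + Complex.I * (sh * S : ℝ))) (ch * S) (sh * C)
        Complex.I)) ↔ sh = 0 := by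
  rw [H.upToScalar_isMatchgate_iff, Complex.ext_iff]
  simp [pow_two]
  constructor
  · rintro ⟨h1, h2⟩
    have e1 : sh ^ 2 * (C ^ 2 - S ^ 2) = 0 := by
      have : ch ^ 2 * (sh ^ 2 * (C ^ 2 - S ^ 2)) = 0 := by grind
      exact (mul_eq_zero.1 this).resolve_left (pow_ne_zero _ hpos.ne')
    have e2 : sh * (C * S) = 0 := by
      have : (ch * (ch ^ 2 + sh ^ 2)) * (sh * (C * S)) = 0 := by grind
      exact (mul_eq_zero.1 this).resolve_left (by positivity)
    have : sh ^ 2 = 0 := by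
      linear_combination (C ^ 2 - S ^ 2) * e1 + 4 * (C * S * sh) * e2 -
        sh ^ 2 * (S ^ 2 + C ^ 2 + 1) * hsc
    simpa using this
  · rintro rfl
    constructor
    · ring
    · ring

/-- The difference of the two sides of the norm condition is C²S²(ch⁴ - sh⁴) = (ch² + sh²)(SC)².
Once SC = 0, the product cc' vanishes as well. -/
theorem isDualUnitary_III_threeTerm_iff (hsc : S ^ 2 + C ^ 2 = 1)
    (hch : ch ^ 2 = sh ^ 2 + 1) (hpos : 0 < ch)
    (H : IsRotPair ((sh * C : ℝ) + Complex.I * (ch * S : ℝ)) (ch * C) (sh * S) (-phase φ₂)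
      (Complex.I * ((ch * C : ℝ) + Complex.I * (sh * S : ℝ))) (ch * S) (sh * C) Complex.I) :
    UpToScalar IsDualUnitary (xType
      (rot ((sh * C : ℝ) + Complex.I * (ch * S : ℝ)) (ch * C) (sh * S) (-phase φ₂))
      (rot (Complex.I * ((ch * C : ℝ) + Complex.I * (sh * S : ℝ))) (ch * S) (sh * C)
        Complex.I)) ↔ S * C = 0 := by
  rw [H.upToScalar_isDualUnitary_iff]
  simp [Complex.normSq_apply]
  constructor
  · rintro ⟨h, -⟩
    have : (ch ^ 2 + sh ^ 2) * (S * C) ^ 2 = 0 := by grind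
    have := (mul_eq_zero.1 this).resolve_left (by positivity)
    simpa using this
  · rintro (rfl | rfl)
    · exact ⟨by ring, .inl (.inr (.inr rfl))⟩
    · exact ⟨by ring, .inl (.inl (.inr rfl))⟩

end BraidIIIThreeTerm

theorem gateIII1_classification {φ₁ φ₂ μ : ℝ} (hM : gateIII1 φ₁ φ₂ μ ≠ 0) :
    UpToScalar (· ∈ Matrix.unitaryGroup (Fin 2 × Fin 2) ℂ) (gateIII1 φ₁ φ₂ μ) ∧
      (UpToScalar IsClifford (gateIII1 φ₁ φ₂ μ) ↔
        μ = 0 ∨ IsIntMul φ₁ π ∨ (IsIntMul (φ₁ - π / 2) π ∧ IsIntMul φ₂ (π / 2))) ∧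
      (UpToScalar IsMatchgate (gateIII1 φ₁ φ₂ μ) ↔ μ = 0) ∧
      ¬ UpToScalar IsNontrivialMatchgate (gateIII1 φ₁ φ₂ μ) ∧
      (UpToScalar IsDualUnitary (gateIII1 φ₁ φ₂ μ) ↔ IsIntMul φ₁ (π / 2)) := by
  have e := gateIII1_eq φ₁ φ₂ μ
  have hk : (-4 * exp μ : ℂ) ≠ 0 := mul_ne_zero (by norm_num) (exp_ofReal_ne_zero μ)
  have hsc := sin_sq_add_cos_sq φ₁
  have hch := cosh_sq (μ / 2)
  have hpos := cosh_pos (μ / 2)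
  have hμ : sinh (μ / 2) = 0 ↔ μ = 0 := by simp
  have H := isRotPair_III_threeTerm hM e
  have hmatch : UpToScalar IsMatchgate (gateIII1 φ₁ φ₂ μ) ↔ μ = 0 := by
    rw [e, upToScalar_smul hk, isMatchgate_III_threeTerm_iff hsc hch hpos H, hμ]
  refine ⟨?_, ?_, hmatch, ?_, ?_⟩
  · rw [e, upToScalar_smul hk]
    exact H.upToScalar_unitary
  · rw [e, upToScalar_smul hk, isClifford_III_threeTerm_iff hsc hch hpos H, hμ, isIntMul_pi_iff,
      isIntMul_sub_pi_div_two_iff]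
  · rw [upToScalar_isNontrivialMatchgate_iff, hmatch]
    rintro ⟨rfl, h⟩
    apply h
    -- At μ = 0 both blocks reduce to i cos φ₁ sin φ₁ times the identity, and the prefactor is -4.
    refine ⟨-4 * (Complex.I * (cos φ₁ * sin φ₁)), ?_⟩
    rw [e, ← xType_one, smul_xType, smul_xType, xType_inj]
    constructor <;> ext i j <;> fin_cases i <;> fin_cases j <;> simp [rot] <;> ring
  · rw [e, upToScalar_smul hk, isDualUnitary_III_threeTerm_iff hsc hch hpos H,
      isIntMul_pi_div_two_iff]

theorem gateIV_classification (φ₁ χ : ℝ) :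
    (UpToScalar IsClifford (gateIV φ₁ χ) ↔
        IsIntMul χ π ∨ (IsIntMul (χ - π / 2) π ∧ IsIntMul φ₁ (π / 2)) ∨
        (IsIntMul (χ - π / 4) (π / 2) ∧ IsIntMul φ₁ π)) ∧
      UpToScalar IsMatchgate (gateIV φ₁ χ) ∧
      ¬ UpToScalar IsDualUnitary (gateIV φ₁ χ) := by
  have hsc := cos_sq_add_sin_sq χ
  have H : IsRotPair 1 (cos χ) (sin χ) (phase φ₁) 1 (cos χ) (sin χ) 1 :=
    ⟨phase_mul_conj φ₁, by simp, by simp [hsc], rfl⟩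
  have hcs : ¬ (cos χ = 0 ∧ sin χ = 0) := by
    rintro ⟨h1, h2⟩
    simp [h1, h2] at hsc
  rw [gateIV_eq_rot]
  refine ⟨?_, H.upToScalar_isMatchgate_iff.2 rfl, ?_⟩
  · have h1 : (1 = phase φ₁ ^ 2 ∧ phase φ₁ ^ 4 = 1) ↔ phase φ₁ ^ 2 = 1 := by
      refine ⟨fun h => h.1.symm, fun h => ⟨h.symm, ?_⟩⟩
      linear_combination (phase φ₁ ^ 2 + 1) * h
    rw [H.upToScalar_isClifford_iff, CliffordRot, isIntMul_pi_iff (t := χ),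
      isIntMul_sub_pi_div_two_iff, isIntMul_sub_pi_div_four_iff, ← phase_pow_four_iff,
      ← phase_sq_eq_one_iff, one_pow, one_pow, h1]
    simp only [map_one, mul_one, Complex.one_re, Complex.one_im, mul_zero, true_and, and_true]
    tauto
  · rw [H.upToScalar_isDualUnitary_iff]
    rintro ⟨h1, h2⟩
    simp at h1 h2
    rw [h2] at h1 hsc
    simp at h1
    exact hcs ⟨h2, by simpa using h1.symm⟩

/-! ### The limit μ → -∞ and dual-unitarity of the limiting braid gates. -/

/-- The gate is polynomial in x, and x = e^μ tends to 0, where only the term with B survives. -/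
theorem tendsto_ybThree_exp_atBot (B : TwoQubit) (l₁ l₂ l₃ : ℂ) :
    Tendsto (fun ν : ℝ => ybThree B l₁ l₂ l₃ (exp ν : ℝ)) atBot (𝓝 (l₃⁻¹ • B)) := by
  have hc : Continuous fun x : ℂ => ybThree B l₁ l₂ l₃ x := by
    unfold ybThree ybAlpha ybBeta ybGamma
    fun_prop
  have h0 : ybThree B l₁ l₂ l₃ ((0 : ℝ) : ℂ) = l₃⁻¹ • B := by
    simp [ybThree, ybAlpha, ybBeta, ybGamma]
  rw [← h0]
  exact (hc.tendsto _).comp ((Complex.continuous_ofReal.tendsto 0).comp tendsto_exp_atBot)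

theorem normSq_phase (θ : ℝ) : Complex.normSq (phase θ) = 1 := by
  have := phase_mul_conj θ
  rw [Complex.mul_conj] at this
  exact_mod_cast this

theorem isDualUnitary_braidGate (l : BraidLabel) (φ₁ φ₂ φ₃ : ℝ) :
    IsDualUnitary ((phase ((φ₂ + φ₃) / 2))⁻¹ • braidGate l φ₁ φ₂ φ₃) := by
  rw [braidGate_eq_rot]
  cases l
  · exact (isDualUnitary_rot_iff (by simp) (neg_I_mul_phase_mul_conj _) (by simp [normSq_phase])
      (by simp)).2 (by simp [normSq_phase])
  · exact (isDualUnitary_rot_iff (neg_I_mul_phase_mul_conj _) (by simp) (by simp)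
      (by simp [normSq_phase])).2 (by simp)

theorem isDualUnitary_braidIII (φ₁ φ₂ : ℝ) :
    IsDualUnitary ((phase φ₁)⁻¹ • braidIII φ₁ φ₂) := by
  rw [braidIII_eq_rot]
  refine (isDualUnitary_rot_iff (phase_mul_conj _) (by simp)
    (by rw [normSq_phase, one_mul, cos_sq_add_sin_sq])
    (by simp [normSq_phase])).2 ⟨by simp [normSq_phase], .inr ?_⟩
  have h : phase (-φ₁) * conj (-Complex.I * phase (-φ₁)) = Complex.I := by
    have := phase_mul_conj (-φ₁)
    simp only [map_mul, map_neg, Complex.conj_I]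
    linear_combination Complex.I * this
  rw [h, Complex.I_re]

/-! ### The main theorem -/

theorem IsIntMul.half {t : ℝ} (h : IsIntMul t π) : IsIntMul t (π / 2) := by
  rw [isIntMul_pi_div_two_iff, isIntMul_pi_iff.1 h, zero_mul]

theorem IsIntMul.half_of_sub {t : ℝ} (h : IsIntMul (t - π / 2) π) : IsIntMul t (π / 2) := by
  rw [isIntMul_pi_div_two_iff, isIntMul_sub_pi_div_two_iff.1 h, mul_zero]

theorem isIntMul_pi_div_two_iff_or {t : ℝ} :
    IsIntMul t (π / 2) ↔ IsIntMul t π ∨ IsIntMul (t - π / 2) π := by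
  rw [isIntMul_pi_div_two_iff, mul_eq_zero, isIntMul_pi_iff, isIntMul_sub_pi_div_two_iff]

theorem isIntMul_pi_div_four {t : ℝ} (h : IsIntMul t (π / 4)) :
    IsIntMul t (π / 2) ∨ IsIntMul (t - π / 4) (π / 2) := by
  obtain ⟨k, rfl⟩ := h
  obtain ⟨m, rfl | rfl⟩ := Int.even_or_odd' k
  · exact .inl ⟨m, by push_cast; ring⟩
  · exact .inr ⟨m, by push_cast; ring⟩

theorem mainTheorem8 (l : BraidLabel) (φ₁ φ₂ φ₃ φ ω μ χ : ℝ)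
    (hφ : φ = (φ₂ + φ₃) / 2 - φ₁) (hω : ω = (φ₂ - φ₃) / 2) :
    -- The gates `R_{I,1}` and `R_{II,1}`
    (gate1 l φ₁ φ₂ φ₃ μ ≠ 0 →
      UpToScalar (· ∈ Matrix.unitaryGroup (Fin 2 × Fin 2) ℂ) (gate1 l φ₁ φ₂ φ₃ μ) ∧
      (IsIntMul ω π ∧ (μ = 0 ∨ IsIntMul φ π) →
        UpToScalar IsClifford (gate1 l φ₁ φ₂ φ₃ μ)) ∧
      (UpToScalar IsClifford (gate1 l φ₁ φ₂ φ₃ μ) ↔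
        μ = 0 ∨ (IsIntMul φ π ∧ IsIntMul ω (π / 2))) ∧
      (UpToScalar IsMatchgate (gate1 l φ₁ φ₂ φ₃ μ) ↔ μ = 0 ∨ IsIntMul (φ - π / 2) π) ∧
      (UpToScalar IsNontrivialMatchgate (gate1 l φ₁ φ₂ φ₃ μ) ↔
        μ ≠ 0 ∧ IsIntMul (φ - π / 2) π) ∧
      (UpToScalar IsDualUnitary (gate1 l φ₁ φ₂ φ₃ μ) ↔ IsIntMul φ π)) ∧
    (Tendsto (fun ν : ℝ => gate1 l φ₁ φ₂ φ₃ ν) atBot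
        (𝓝 ((phase ((φ₂ + φ₃) / 2))⁻¹ • braidGate l φ₁ φ₂ φ₃)) ∧
      IsDualUnitary ((phase ((φ₂ + φ₃) / 2))⁻¹ • braidGate l φ₁ φ₂ φ₃)) ∧
    -- The gates `R_{I,2}` and `R_{II,2}`
    (gate2 l φ₁ φ₂ φ₃ μ ≠ 0 →
      (IsIntMul ω π ∧ (μ = 0 ∨ IsIntMul φ π ∨
          (cos (φ / 2) ≠ 0 ∧ (tanh (μ / 2) = tan (φ / 2) ∨ tanh (μ / 2) = -tan (φ / 2)))) →
        UpToScalar IsClifford (gate2 l φ₁ φ₂ φ₃ μ)) ∧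
      (UpToScalar IsClifford (gate2 l φ₁ φ₂ φ₃ μ) ↔
        IsIntMul ω (π / 2) ∧ (μ = 0 ∨ IsIntMul φ π ∨
          (cos (φ / 2) ≠ 0 ∧ (tanh (μ / 2) = tan (φ / 2) ∨ tanh (μ / 2) = -tan (φ / 2))))) ∧
      (UpToScalar IsMatchgate (gate2 l φ₁ φ₂ φ₃ μ) ↔
        cos (φ / 2) ≠ 0 ∧ (tanh (μ / 2) = tan (φ / 2) ∨ tanh (μ / 2) = -tan (φ / 2))) ∧
      UpToScalar IsDualUnitary (gate2 l φ₁ φ₂ φ₃ μ)) ∧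
    -- The gates `R_{I,3}` and `R_{II,3}`
    (gate3 l φ₁ φ₂ φ₃ μ ≠ 0 →
      (IsIntMul ω π ∧ (μ = 0 ∨ IsIntMul φ π ∨
          (sin (φ / 2) ≠ 0 ∧ (tanh (μ / 2) = cot (φ / 2) ∨ tanh (μ / 2) = -cot (φ / 2)))) →
        UpToScalar IsClifford (gate3 l φ₁ φ₂ φ₃ μ)) ∧
      (UpToScalar IsClifford (gate3 l φ₁ φ₂ φ₃ μ) ↔
        IsIntMul ω (π / 2) ∧ (μ = 0 ∨ IsIntMul φ π ∨
          (sin (φ / 2) ≠ 0 ∧ (tanh (μ / 2) = cot (φ / 2) ∨ tanh (μ / 2) = -cot (φ / 2))))) ∧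
      (UpToScalar IsMatchgate (gate3 l φ₁ φ₂ φ₃ μ) ↔
        sin (φ / 2) ≠ 0 ∧ (tanh (μ / 2) = cot (φ / 2) ∨ tanh (μ / 2) = -cot (φ / 2))) ∧
      UpToScalar IsDualUnitary (gate3 l φ₁ φ₂ φ₃ μ)) ∧
    -- The gate `R_{III,1}`
    (gateIII1 φ₁ φ₂ μ ≠ 0 →
      UpToScalar (· ∈ Matrix.unitaryGroup (Fin 2 × Fin 2) ℂ) (gateIII1 φ₁ φ₂ μ) ∧
      (IsIntMul (φ₂ - π / 2) π ∧ (μ = 0 ∨ IsIntMul φ₁ (π / 2)) →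
        UpToScalar IsClifford (gateIII1 φ₁ φ₂ μ)) ∧
      (UpToScalar IsClifford (gateIII1 φ₁ φ₂ μ) ↔
        μ = 0 ∨ IsIntMul φ₁ π ∨ (IsIntMul (φ₁ - π / 2) π ∧ IsIntMul φ₂ (π / 2))) ∧
      (UpToScalar IsMatchgate (gateIII1 φ₁ φ₂ μ) ↔ μ = 0) ∧
      ¬ UpToScalar IsNontrivialMatchgate (gateIII1 φ₁ φ₂ μ) ∧
      (UpToScalar IsDualUnitary (gateIII1 φ₁ φ₂ μ) ↔ IsIntMul φ₁ (π / 2))) ∧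
    (Tendsto (fun ν : ℝ => gateIII1 φ₁ φ₂ ν) atBot (𝓝 ((phase φ₁)⁻¹ • braidIII φ₁ φ₂)) ∧
      IsDualUnitary ((phase φ₁)⁻¹ • braidIII φ₁ φ₂)) ∧
    -- The gate `R_{III,2}`
    (gateIII2 φ₁ φ₂ μ ≠ 0 →
      (IsIntMul (φ₂ - π / 2) π ∧ (μ = 0 ∨ IsIntMul (φ₁ - π / 2) π ∨ IsIntMul φ₁ π) →
        UpToScalar IsClifford (gateIII2 φ₁ φ₂ μ)) ∧
      (UpToScalar IsClifford (gateIII2 φ₁ φ₂ μ) ↔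
        IsIntMul φ₁ π ∨
        ((μ = 0 ∨ IsIntMul (φ₁ - π / 2) π) ∧ IsIntMul φ₂ (π / 2)) ∨
        (cos φ₁ ≠ 0 ∧ (tanh (μ / 2) = tan φ₁ ∨ tanh (μ / 2) = -tan φ₁) ∧
          IsIntMul (φ₂ - π / 2) π)) ∧
      ¬ UpToScalar IsMatchgate (gateIII2 φ₁ φ₂ μ) ∧
      UpToScalar IsDualUnitary (gateIII2 φ₁ φ₂ μ)) ∧
    -- The gate `R_{III,3}`
    (gateIII3 φ₁ φ₂ μ ≠ 0 →
      (IsIntMul (φ₂ - π / 2) π ∧ (μ = 0 ∨ IsIntMul (φ₁ - π / 2) π ∨ IsIntMul φ₁ π) →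
        UpToScalar IsClifford (gateIII3 φ₁ φ₂ μ)) ∧
      (UpToScalar IsClifford (gateIII3 φ₁ φ₂ μ) ↔
        μ = 0 ∨ IsIntMul φ₁ π ∨
        (IsIntMul (φ₁ - π / 2) π ∧ IsIntMul φ₂ (π / 2)) ∨
        (sin φ₁ ≠ 0 ∧ (tanh (μ / 2) = cot φ₁ ∨ tanh (μ / 2) = -cot φ₁) ∧
          IsIntMul (φ₂ - π / 2) π)) ∧
      ¬ UpToScalar IsMatchgate (gateIII3 φ₁ φ₂ μ) ∧
      UpToScalar IsDualUnitary (gateIII3 φ₁ φ₂ μ)) ∧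
    -- The gate `R_IV`
    ((IsIntMul φ₁ π ∧ IsIntMul χ (π / 4) → UpToScalar IsClifford (gateIV φ₁ χ)) ∧
      (UpToScalar IsClifford (gateIV φ₁ χ) ↔
        IsIntMul χ π ∨ (IsIntMul (χ - π / 2) π ∧ IsIntMul φ₁ (π / 2)) ∨
        (IsIntMul (χ - π / 4) (π / 2) ∧ IsIntMul φ₁ π)) ∧
      UpToScalar IsMatchgate (gateIV φ₁ χ) ∧
      ¬ UpToScalar IsDualUnitary (gateIV φ₁ χ)) := by
  refine ⟨fun hM => ?_, ⟨tendsto_ybThree_exp_atBot _ _ _ _, isDualUnitary_braidGate l φ₁ φ₂ φ₃⟩,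
    fun hM => ?_, fun hM => ?_, fun hM => ?_,
    ⟨tendsto_ybThree_exp_atBot _ _ _ _, isDualUnitary_braidIII φ₁ φ₂⟩, fun hM => ?_, fun hM => ?_,
    ?_⟩
  · obtain ⟨h1, h2, h3, h4, h5⟩ := gate1_classification l hφ hω hM
    exact ⟨h1, fun ⟨hw, h⟩ => h2.2 (h.imp_right fun h => ⟨h, hw.half⟩), h2, h3, h4, h5⟩
  · obtain ⟨h1, h2, h3⟩ := gate2_classification l hφ hω hM
    exact ⟨fun ⟨hw, h⟩ => h1.2 ⟨hw.half, h⟩, h1, h2, h3⟩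
  · obtain ⟨h1, h2, h3⟩ := gate3_classification l hφ hω hM
    exact ⟨fun ⟨hw, h⟩ => h1.2 ⟨hw.half, h⟩, h1, h2, h3⟩
  · obtain ⟨h1, h2, h3, h4, h5⟩ := gateIII1_classification hM
    exact ⟨h1, fun ⟨hz, h⟩ => h2.2 (h.imp_right fun h =>
      (isIntMul_pi_div_two_iff_or.1 h).imp_right fun h => ⟨h, hz.half_of_sub⟩), h2, h3, h4, h5⟩
  · obtain ⟨h1, h2, h3⟩ := gateIII2_classification hM
    refine ⟨fun ⟨hz, h⟩ => h1.2 ?_, h1, h2, h3⟩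
    have := hz.half_of_sub
    tauto
  · obtain ⟨h1, h2, h3⟩ := gateIII3_classification hM
    refine ⟨fun ⟨hz, h⟩ => h1.2 ?_, h1, h2, h3⟩
    have := hz.half_of_sub
    tauto
  · obtain ⟨h1, h2, h3⟩ := gateIV_classification φ₁ χ
    refine ⟨fun ⟨hz, h⟩ => h1.2 ?_, h1, h2, h3⟩
    have := hz.half
    rcases isIntMul_pi_div_four h with h | h
    · rcases isIntMul_pi_div_two_iff_or.1 h with h | h <;> tauto
    · tauto
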